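/- Let $(\Omega,\mathcal A,\mathbb P)$ be a probability space, $\theta:\Omega\to\Omega$ a bijective, bi-measurable map preserving $\mathbb P$, and $\mathcal F_0\subseteq\mathcal A$ a $\sigma$-algebra with $\mathcal F_0\subseteq\theta^{-1}(\mathcal F_0)$. For $i\in\mathbb Z$ put $\mathcal F_i=\theta^{-i}(\mathcal F_0)$, $\mathbb E_i(\cdot)=\mathbb E(\cdot\mid\mathcal F_i)$ and $\mathcal P_0=\mathbb E_0-\mathbb E_{-1}$. Let $X_0$ be a real, centered, square integrable, $\mathcal F_0$-measurable random variable, $X_i=X_0\circ\theta^i$ and $S_n=X_1+\dots+X_n$. Assume the Maxwell--Woodroofe condition $$\sum_{n\ge1}\frac{\|\mathbb E_0(S_n)\|_2}{n^{3/2}}<\infty .$$ Then the series $$D=\sum_{n\ge0}\ \sum_{k\ge n}\frac{\mathcal P_0(X_k)}{k+1}$$ converges in $\mathbb L^2$ (each inner series converges in $\mathbb L^2$, and so does the series of their sums) and, with $M_n=\sum_{k=1}^nD\circ\theta^k$, as $n\to\infty$, $$\mathbb E_0\big[(S_n-M_n-\mathbb E_0(S_n))^2\big]=o(n)\quad\text{and}\quad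 \mathbb E_0(S_n)=o(\sqrt n)\qquad\mathbb P\text{-a.s.}$$ In particular, $\mathbb E_0[(S_n-M_n)^2]=o(n)$ $\mathbb P$-a.s. -/

import Mathlib

open MeasureTheory Filter Topology Asymptotics

namespace QuenchedApprox

/-- The iterate `θ^i` (with `i ∈ ℤ`) of a bijective bi-measurable transformation. -/
def iter {Ω : Type*} [MeasurableSpace Ω] (θ : Ω ≃ᵐ Ω) (i : ℤ) : Ω → Ω :=
  ⇑((θ.toEquiv : Equiv.Perm Ω) ^ i)

/-- The σ-algebra `F_i = θ^{-i}(F₀)`, i.e. the sets `{ω | θ^i ω ∈ A}` with `A ∈ F₀`. -/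
@[reducible]
def sigmaAlg {Ω : Type*} (F₀ : MeasurableSpace Ω) [MeasurableSpace Ω]
    (θ : Ω ≃ᵐ Ω) (i : ℤ) : MeasurableSpace Ω :=
  MeasurableSpace.comap (iter θ i) F₀

theorem sigmaAlg_zero {Ω : Type*} (F₀ : MeasurableSpace Ω) [MeasurableSpace Ω]
    (θ : Ω ≃ᵐ Ω) : sigmaAlg F₀ θ 0 = F₀ := by
  have h : iter θ 0 = id := by
    funext x
    simp [iter]
  rw [sigmaAlg, h, MeasurableSpace.comap_id]

/-- The partial sums `∑_{k=1}^n Z ∘ θ^k`. For `Z = X₀` this is `S_n`, for `Z = D` it is `M_n`. -/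
def partialSum {Ω : Type*} [MeasurableSpace Ω] (θ : Ω ≃ᵐ Ω) (Z : Ω → ℝ) (n : ℕ) : Ω → ℝ :=
  fun ω => ∑ k ∈ Finset.Icc 1 n, Z (iter θ (k : ℤ) ω)

/-- The projection `P_k(Z) = E(Z | F_k) - E(Z | F_{k-1})`. -/
noncomputable def proj {Ω : Type*} (F₀ : MeasurableSpace Ω) [MeasurableSpace Ω]
    (μ : Measure Ω) (θ : Ω ≃ᵐ Ω) (k : ℤ) (Z : Ω → ℝ) : Ω → ℝ :=
  μ[Z | sigmaAlg F₀ θ k] - μ[Z | sigmaAlg F₀ θ (k - 1)]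

/-- `D = ∑_{n ≥ 0} ∑_{k ≥ n} P_0(X_k) / (k + 1)`, where `X_k = X₀ ∘ θ^k`: for every `n` the inner
series converges in `L²` (to `R n`), and the outer series `∑_n R n` converges in `L²` to `D`. -/
def IsMartingaleDiff {Ω : Type*} (F₀ : MeasurableSpace Ω) [MeasurableSpace Ω]
    (μ : Measure Ω) (θ : Ω ≃ᵐ Ω) (X₀ : Ω → ℝ) (D : Ω → ℝ) : Prop :=
  ∃ R : ℕ → Ω → ℝ,
    (∀ n, MemLp (R n) 2 μ ∧
      Tendsto (fun m : ℕ => eLpNorm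
        (fun ω => (∑ k ∈ Finset.Ico n m,
            proj F₀ μ θ 0 (fun ω' => X₀ (iter θ (k : ℤ) ω')) ω / ((k : ℝ) + 1)) - R n ω) 2 μ)
        atTop (𝓝 0)) ∧
    MemLp D 2 μ ∧
    Tendsto (fun N : ℕ => eLpNorm
      (fun ω => (∑ n ∈ Finset.range N, R n ω) - D ω) 2 μ) atTop (𝓝 0)

/-- The Maxwell–Woodroofe condition `∑_{n ≥ 1} ‖E(S_n | F₀)‖₂ / n^{3/2} < ∞`. -/
def MaxwellWoodroofe {Ω : Type*} (F₀ : MeasurableSpace Ω) [MeasurableSpace Ω]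
    (μ : Measure Ω) (θ : Ω ≃ᵐ Ω) (X₀ : Ω → ℝ) : Prop :=
  ∑' n : ℕ, eLpNorm (μ[partialSum θ X₀ (n + 1) | F₀]) 2 μ /
    ENNReal.ofReal (((n : ℝ) + 1) ^ (3 / 2 : ℝ)) < ⊤

end QuenchedApprox

/-! Write `T` for θ, `m` for F₀ and Q h = E(h ∘ T | m), a positive contraction of L². With d = D ∘
θ, which is T⁻¹m-measurable and satisfies E(d | m) = 0, everything uses only forward iterates: S_n
is `shiftSum T X₀ n` and M_n is a.s. `orbitSum T d n`.

For a coboundary X₀ = y - Qy, S_n is the martingale with difference y ∘ T - Qy plus Qy - (Qy) ∘ T^n,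
and the boundary terms are negligible because E₀[g² ∘ T^n] = o(n) a.s. for g in L². The
Maxwell–Woodroofe condition makes X₀ such a coboundary up to a remainder z, the average 2^{-r}(Q + ⋯
+ Q^{2^r})X₀, whose dyadic norm ‖z‖₂ + ∑_k 2^{-k/2}‖E₀(S_{2^k}(z))‖₂ is as small as desired
(`exists_coboundary_approx`).

The remainder is controlled by `exists_condNorm_shiftSum_le`: E₀[S_n(z)²]^{1/2} ≤ √n Ψ for all n,
with E Ψ at most six times the dyadic norm. It comes from chaining: pairing the terms of a sum of
level-k conditional sums gives a level-(k+1) sum plus a martingale. Conditional Pythagoras and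
Hopf's maximal lemma for Q bound each martingale by √n times a function whose L¹ norm is at most
twice the L² norm of the difference. Since the E Ψ are arbitrarily small,
`ae_tendsto_zero_of_forall_exists_le` yields the a.s. statement.

The same chaining in L² shows that the differences of the approximating coboundaries are Cauchy, and
d is obtained from their limit. To identify d with the series, an orthogonal decomposition gives
∑_{k≤n} ‖∑_{j<k} P₀X_j - D‖² ≤ ‖S_n - M_n‖² = o(n). Hence the partial sums of ∑ P₀X_j tend to D in
Cesàro mean, and summation by parts turns this into convergence of the iterated series.

Once E₀[(S_n - M_n)²] = o(n) is known, the other two claims follow from E₀(M_n) = 0: one is a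
conditional variance bound, the other conditional Jensen. -/

namespace QuenchedApprox

set_option linter.unusedSectionVars false

/-! ### Conditional expectation along a measure preserving map -/

section Shift

variable {Ω : Type*} {m : MeasurableSpace Ω} [mΩ : MeasurableSpace Ω] {μ : Measure Ω}
  [IsProbabilityMeasure μ] {T : Ω → Ω}

theorem comap_le_of_measurePreserving (hT : MeasurePreserving T μ μ) (hm : m ≤ mΩ) :
    m.comap T ≤ mΩ :=
  (MeasurableSpace.comap_mono hm).trans hT.measurable.comap_le

theorem le_comap_iterate (hmT : m ≤ m.comap T) (p : ℕ) : m ≤ m.comap T^[p] := by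
  induction p with
  | zero => simp [MeasurableSpace.comap_id]
  | succ p ih =>
    rw [Function.iterate_succ, ← MeasurableSpace.comap_comp]
    exact hmT.trans (MeasurableSpace.comap_mono ih)

theorem stronglyMeasurable_comp_comap {f : Ω → ℝ} (hf : StronglyMeasurable[m] f) :
    StronglyMeasurable[m.comap T] (f ∘ T) :=
  hf.comp_measurable (comap_measurable T)

/-- Conditional expectation commutes with a measure preserving map. -/
theorem condExp_comp_comap (hT : MeasurePreserving T μ μ) (hm : m ≤ mΩ) {f : Ω → ℝ}
    (hf : Integrable f μ) : μ[f ∘ T | m.comap T] =ᵐ[μ] μ[f | m] ∘ T := by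
  have hle := comap_le_of_measurePreserving hT hm
  refine (ae_eq_condExp_of_forall_setIntegral_eq hle (hT.integrable_comp_of_integrable hf)
    (fun s _ _ => (hT.integrable_comp_of_integrable integrable_condExp).integrableOn) ?_ ?_).symm
  · rintro s ⟨t, ht, rfl⟩ -
    have h1 : ∀ g : Ω → ℝ, Integrable g μ →
        ∫ x in T ⁻¹' t, (g ∘ T) x ∂μ = ∫ x in t, g x ∂μ := by
      intro g hg
      have hr : MeasurePreserving T (μ.restrict (T ⁻¹' t)) (μ.restrict t) :=
        hT.restrict_preimage (hm t ht)
      have := integral_map (μ := μ.restrict (T ⁻¹' t)) hT.measurable.aemeasurable (f := g)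
        (by rw [hr.map_eq]; exact hg.aestronglyMeasurable.restrict)
      rw [hr.map_eq] at this
      exact this.symm
    rw [h1 _ integrable_condExp, h1 _ hf, setIntegral_condExp hm hf ht]
  · exact (stronglyMeasurable_comp_comap stronglyMeasurable_condExp).aestronglyMeasurable

/-- The tower property through T⁻¹m ⊇ m. It makes the iterates of Q equal to h ↦ E(h ∘ T^j | m). -/
theorem condExp_condExp_comp (hT : MeasurePreserving T μ μ) (hm : m ≤ mΩ)
    (hmT : m ≤ m.comap T) {f : Ω → ℝ} (hf : Integrable f μ) :
    μ[μ[f | m] ∘ T | m] =ᵐ[μ] μ[f ∘ T | m] :=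
  (condExp_congr_ae (condExp_comp_comap hT hm hf).symm).trans
    (condExp_condExp_of_le hmT (comap_le_of_measurePreserving hT hm))

theorem memLp_sum_iterate (hT : MeasurePreserving T μ μ) {d : Ω → ℝ} (hd : MemLp d 2 μ) (n : ℕ) :
    MemLp (fun ω => ∑ j ∈ Finset.range n, d (T^[j] ω)) 2 μ :=
  memLp_finsetSum _ fun j _ => hd.comp_measurePreserving (hT.iterate j)

/-- The sum of the first `n + 1` iterates splits off the first term. -/
theorem sum_iterate_succ (d : Ω → ℝ) (n : ℕ) :
    (fun ω => ∑ j ∈ Finset.range (n + 1), d (T^[j] ω)) =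
      d + (fun ω => ∑ j ∈ Finset.range n, d (T^[j] ω)) ∘ T := by
  funext ω
  simp [Finset.sum_range_succ', add_comm]

theorem condExp_comp_ae_zero (hT : MeasurePreserving T μ μ) (hm : m ≤ mΩ)
    (hmT : m ≤ m.comap T) {f : Ω → ℝ} (hf : Integrable f μ) (h0 : μ[f | m] =ᵐ[μ] 0) :
    μ[f ∘ T | m] =ᵐ[μ] 0 := by
  refine (condExp_condExp_comp hT hm hmT hf).symm.trans ?_
  have : μ[f | m] ∘ T =ᵐ[μ] (0 : Ω → ℝ) := hT.quasiMeasurePreserving.ae_eq_comp h0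
  refine (condExp_congr_ae this).trans ?_
  rw [condExp_zero]

theorem condExp_sum_iterate_ae_zero (hT : MeasurePreserving T μ μ) (hm : m ≤ mΩ)
    (hmT : m ≤ m.comap T) {d : Ω → ℝ} (hd : MemLp d 2 μ) (h0 : μ[d | m] =ᵐ[μ] 0) (n : ℕ) :
    μ[fun ω => ∑ j ∈ Finset.range n, d (T^[j] ω) | m] =ᵐ[μ] 0 := by
  induction n with
  | zero =>
    have : (fun ω => ∑ j ∈ Finset.range 0, d (T^[j] ω)) = (0 : Ω → ℝ) := by funext; simp
    rw [this, condExp_zero]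
  | succ n ih =>
    rw [sum_iterate_succ]
    have hs := (memLp_sum_iterate hT hd n)
    have hi := hs.integrable (by norm_num)
    refine (condExp_add (hd.integrable (by norm_num)) (hT.integrable_comp_of_integrable hi) m).trans
      ?_
    filter_upwards [h0, condExp_comp_ae_zero hT hm hmT hi ih] with ω h1 h2
    simp [h1, h2]

/-- Conditional Pythagoras identity for stationary martingale differences. -/
theorem condExp_sq_sum_iterate (hT : MeasurePreserving T μ μ) (hm : m ≤ mΩ)
    (hmT : m ≤ m.comap T) {d : Ω → ℝ} (hd : MemLp d 2 μ)
    (hdm : StronglyMeasurable[m.comap T] d) (h0 : μ[d | m] =ᵐ[μ] 0) (n : ℕ) :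
    μ[fun ω => (∑ j ∈ Finset.range n, d (T^[j] ω)) ^ 2 | m] =ᵐ[μ]
      fun ω => ∑ j ∈ Finset.range n, (μ[fun ω' => d (T^[j] ω') ^ 2 | m]) ω := by
  induction n with
  | zero =>
    have : (fun ω => (∑ j ∈ Finset.range 0, d (T^[j] ω)) ^ 2) = (0 : Ω → ℝ) := by funext; simp
    rw [this, condExp_zero]
    simp; rfl
  | succ n ih =>
    set s : Ω → ℝ := fun ω => ∑ j ∈ Finset.range n, d (T^[j] ω) with hs
    have hsL : MemLp s 2 μ := memLp_sum_iterate hT hd n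
    have hsi := hsL.integrable (q := 2) (by norm_num)
    have hsT : MemLp (s ∘ T) 2 μ := hsL.comp_measurePreserving hT
    have hle := comap_le_of_measurePreserving hT hm
    have hexp : (fun ω => (∑ j ∈ Finset.range (n + 1), d (T^[j] ω)) ^ 2) =
        ((fun ω => d ω ^ 2) + (2 : ℝ) • (d * (s ∘ T))) + (fun ω => s ω ^ 2) ∘ T := by
      funext ω
      have := congrFun (sum_iterate_succ (T := T) d n) ω
      simp only [Pi.add_apply, Pi.smul_apply, Pi.mul_apply, Function.comp_apply, smul_eq_mul]
        at this ⊢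
      rw [this]; ring
    have hi1 : Integrable (fun ω => d ω ^ 2) μ := hd.integrable_sq
    have hi2 : Integrable (d * (s ∘ T)) μ := hd.integrable_mul hsT
    have hi3 : Integrable (fun ω => s ω ^ 2) μ := hsL.integrable_sq
    have hi3' := hT.integrable_comp_of_integrable hi3
    -- Condition first on T⁻¹m: there d factors out and E(s ∘ T | T⁻¹m) = E(s | m) ∘ T = 0.
    have hcross : μ[d * (s ∘ T) | m] =ᵐ[μ] 0 := by
      have h1 : μ[d * (s ∘ T) | m.comap T] =ᵐ[μ] 0 := by
        refine (condExp_mul_of_stronglyMeasurable_left hdm hi2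
          (hsT.integrable (by norm_num))).trans ?_
        have h2 : μ[s | m] ∘ T =ᵐ[μ] (0 : Ω → ℝ) :=
          hT.quasiMeasurePreserving.ae_eq_comp (condExp_sum_iterate_ae_zero hT hm hmT hd h0 n)
        filter_upwards [condExp_comp_comap hT hm hsi, h2] with ω h3 h4
        have h5 : (μ[s | m]) (T ω) = 0 := h4
        simp [h3, h5]
      refine (condExp_condExp_of_le hmT hle).symm.trans ((condExp_congr_ae h1).trans ?_)
      rw [condExp_zero]
    have hlast : μ[(fun ω => s ω ^ 2) ∘ T | m] =ᵐ[μ]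
        fun ω => ∑ j ∈ Finset.range n, (μ[fun ω' => d (T^[j + 1] ω') ^ 2 | m]) ω := by
      have hint : ∀ j : ℕ, Integrable (fun ω' => d (T^[j] ω') ^ 2) μ := fun j =>
        (hd.comp_measurePreserving (hT.iterate j)).integrable_sq
      refine (condExp_condExp_comp hT hm hmT hi3).symm.trans ?_
      have h1 : μ[fun ω => s ω ^ 2 | m] ∘ T =ᵐ[μ]
          ∑ j ∈ Finset.range n, (μ[fun ω' => d (T^[j] ω') ^ 2 | m]) ∘ T := by
        filter_upwards [hT.quasiMeasurePreserving.ae_eq_comp ih] with ω h2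
        simpa using h2
      refine (condExp_congr_ae h1).trans ((condExp_finsetSum (fun j _ =>
        hT.integrable_comp_of_integrable integrable_condExp) m).trans ?_)
      have h3 : ∀ᵐ ω ∂μ, ∀ j : ℕ, (μ[μ[fun ω' => d (T^[j] ω') ^ 2 | m] ∘ T | m]) ω =
          (μ[fun ω' => d (T^[j + 1] ω') ^ 2 | m]) ω :=
        ae_all_iff.2 fun j => condExp_condExp_comp hT hm hmT (hint j)
      filter_upwards [h3] with ω h4
      simp [h4]
    rw [hexp]
    filter_upwards [condExp_add (hi1.add (hi2.smul (2 : ℝ))) hi3' m,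
      condExp_add hi1 (hi2.smul (2 : ℝ)) m, condExp_smul (2 : ℝ) (d * (s ∘ T)) m, hcross,
      hlast] with ω h1 h2 h3 h4 h5
    rw [h1, Pi.add_apply, h2, Pi.add_apply, h3, Pi.smul_apply, h4, h5, Finset.sum_range_succ']
    simp [add_comm]

end Shift

/-! ### The conditional L² norm -/

section CondNorm

/-- The conditional `L²` norm `E(f² | m)^{1/2}`. -/
noncomputable def condNorm {Ω : Type*} (m : MeasurableSpace Ω) [MeasurableSpace Ω]
    (μ : Measure Ω) (f : Ω → ℝ) (ω : Ω) : ENNReal :=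
  ENNReal.ofReal √((μ[fun ω' => f ω' ^ 2 | m]) ω)

/-- Optimising over t in (1 + t)a + (1 + 1/t)b gives (√a + √b)². Rational t suffice by continuity,
and countability of the parameters is what allows the almost sure application. -/
theorem sqrt_le_sqrt_add_sqrt_of_forall_rat {a b c : ℝ} (ha : 0 ≤ a) (hb : 0 ≤ b)
    (h : ∀ t : ℚ, 0 < t → c ≤ (1 + (t : ℝ)) * a + (1 + (t : ℝ)⁻¹) * b) : √c ≤ √a + √b := by
  have hreal : ∀ t : ℝ, 0 < t → c ≤ (1 + t) * a + (1 + t⁻¹) * b := by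
    intro t ht
    by_contra! hlt
    have hcont : ContinuousAt (fun s : ℝ => (1 + s) * a + (1 + s⁻¹) * b) t := by
      have : ContinuousAt (fun s : ℝ => s⁻¹) t := continuousAt_inv₀ ht.ne'
      fun_prop
    have hev := (hcont.eventually (gt_mem_nhds hlt)).and (lt_mem_nhds ht)
    obtain ⟨q, hq1, hq2⟩ := Rat.denseRange_cast.exists_mem_open (isOpen_interior)
      (⟨t, mem_interior_iff_mem_nhds.2 hev⟩ : (interior {s : ℝ | (1 + s) * a + (1 + s⁻¹) * b < c
        ∧ 0 < s}).Nonempty) |>.imp fun q hq => interior_subset hq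
    exact absurd (h q (by exact_mod_cast hq2)) (not_le.2 hq1)
  set x := √a with hx
  set y := √b with hy
  have hx0 : 0 ≤ x := Real.sqrt_nonneg a
  have hy0 : 0 ≤ y := Real.sqrt_nonneg b
  have hxa : a = x ^ 2 := (Real.sq_sqrt ha).symm
  have hyb : b = y ^ 2 := (Real.sq_sqrt hb).symm
  have hδ : ∀ δ : ℝ, 0 < δ → c ≤ (x + y) ^ 2 + δ * (x + y) := by
    intro δ hδ
    -- The optimal t is y / x; the shift by δ keeps it positive and finite when x or y vanishes.
    refine (hreal ((y + δ) / (x + δ)) (by positivity)).trans ?_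
    have h1 : (y + δ) / (x + δ) * a ≤ x * (y + δ) := by
      rw [hxa, div_mul_eq_mul_div, div_le_iff₀ (by positivity)]
      nlinarith [mul_nonneg (mul_nonneg hx0 hδ.le) (add_nonneg hy0 hδ.le)]
    have h2 : ((y + δ) / (x + δ))⁻¹ * b ≤ y * (x + δ) := by
      rw [hyb, inv_div, div_mul_eq_mul_div, div_le_iff₀ (by positivity)]
      nlinarith [mul_nonneg (mul_nonneg hy0 hδ.le) (add_nonneg hx0 hδ.le)]
    nlinarith
  have hc : c ≤ (x + y) ^ 2 := by
    have ht : Tendsto (fun δ : ℝ => (x + y) ^ 2 + δ * (x + y)) (𝓝[>] 0) (𝓝 ((x + y) ^ 2 + 0 * (x + y))) :=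
      (Continuous.tendsto (by fun_prop) 0).mono_left nhdsWithin_le_nhds
    have := ge_of_tendsto ht (eventually_mem_nhdsWithin.mono fun δ h => hδ δ h)
    simpa using this
  exact Real.sqrt_le_iff.2 ⟨by positivity, hc⟩

variable {Ω : Type*} {m : MeasurableSpace Ω} [mΩ : MeasurableSpace Ω] {μ : Measure Ω}
  [IsProbabilityMeasure μ] {T : Ω → Ω}

theorem condNorm_congr {f g : Ω → ℝ} (h : f =ᵐ[μ] g) :
    condNorm m μ f =ᵐ[μ] condNorm m μ g := by
  have : (fun ω => f ω ^ 2) =ᵐ[μ] fun ω => g ω ^ 2 := h.mono fun ω h => by simp [h]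
  filter_upwards [condExp_congr_ae (m := m) this] with ω h
  simp [condNorm, h]

/-- Conditional Minkowski inequality. -/
theorem condNorm_add_le {f g : Ω → ℝ} (hf : MemLp f 2 μ) (hg : MemLp g 2 μ) :
    ∀ᵐ ω ∂μ, condNorm m μ (f + g) ω ≤ condNorm m μ f ω + condNorm m μ g ω := by
  have hf2 := hf.integrable_sq
  have hg2 := hg.integrable_sq
  have key : ∀ᵐ ω ∂μ, ∀ t : ℚ, 0 < t → (μ[fun ω' => (f + g) ω' ^ 2 | m]) ω ≤
      (1 + (t : ℝ)) * (μ[fun ω' => f ω' ^ 2 | m]) ω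
        + (1 + (t : ℝ)⁻¹) * (μ[fun ω' => g ω' ^ 2 | m]) ω := by
    refine ae_all_iff.2 fun t => ?_
    by_cases ht : 0 < t
    swap
    · exact Eventually.of_forall fun ω h => absurd h ht
    have ht' : (0 : ℝ) < t := by exact_mod_cast ht
    have hle : (fun ω' => (f + g) ω' ^ 2) ≤ᵐ[μ] (1 + (t : ℝ)) • (fun ω' => f ω' ^ 2) +
        (1 + (t : ℝ)⁻¹) • (fun ω' => g ω' ^ 2) := by
      refine Eventually.of_forall fun ω => ?_
      simp only [Pi.add_apply, Pi.smul_apply, smul_eq_mul]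
      have h1 : 0 ≤ (t : ℝ)⁻¹ * (t * f ω - g ω) ^ 2 := by positivity
      have h2 : (t : ℝ)⁻¹ * (t * f ω - g ω) ^ 2 =
          t * f ω ^ 2 - 2 * f ω * g ω + (t : ℝ)⁻¹ * g ω ^ 2 := by
        field_simp
        ring
      nlinarith
    filter_upwards [condExp_mono (m := m) (hf.add hg).integrable_sq
      ((hf2.smul (1 + (t : ℝ))).add (hg2.smul (1 + (t : ℝ)⁻¹))) hle,
      condExp_add (hf2.smul (1 + (t : ℝ))) (hg2.smul (1 + (t : ℝ)⁻¹)) m,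
      condExp_smul (1 + (t : ℝ)) (fun ω' => f ω' ^ 2) m,
      condExp_smul (1 + (t : ℝ)⁻¹) (fun ω' => g ω' ^ 2) m] with ω h1 h2 h3 h4 _
    rw [h2, Pi.add_apply, h3, h4] at h1
    simpa using h1
  have hfn : 0 ≤ᵐ[μ] μ[fun ω' => f ω' ^ 2 | m] :=
    condExp_nonneg (Eventually.of_forall fun ω => sq_nonneg _)
  have hgn : 0 ≤ᵐ[μ] μ[fun ω' => g ω' ^ 2 | m] :=
    condExp_nonneg (Eventually.of_forall fun ω => sq_nonneg _)
  filter_upwards [key, hfn, hgn] with ω h1 h2 h3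
  rw [condNorm, condNorm, condNorm, ← ENNReal.ofReal_add (Real.sqrt_nonneg _) (Real.sqrt_nonneg _)]
  exact ENNReal.ofReal_le_ofReal (sqrt_le_sqrt_add_sqrt_of_forall_rat h2 h3 h1)

theorem eLpNorm_two_eq {f : Ω → ℝ} (hf : MemLp f 2 μ) :
    eLpNorm f 2 μ = ENNReal.ofReal √(∫ ω, f ω ^ 2 ∂μ) := by
  rw [hf.eLpNorm_eq_integral_rpow_norm (by norm_num) (by norm_num), Real.sqrt_eq_rpow]
  simp

end CondNorm

/-! ### Hopf's maximal lemma and the maximal function -/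

section Maximal

variable {Ω : Type*} {m : MeasurableSpace Ω} [mΩ : MeasurableSpace Ω] {μ : Measure Ω}
  [IsProbabilityMeasure μ] {T : Ω → Ω}

theorem partialSups_spec (A : ℕ → Ω → ℝ) (N : ℕ) (ω : Ω) :
    (∀ n ≤ N, A n ω ≤ partialSups A N ω) ∧ ∃ n ≤ N, partialSups A N ω = A n ω := by
  refine ⟨fun n hn => le_partialSups_of_le A hn ω, ?_⟩
  induction N with
  | zero => exact ⟨0, le_rfl, by simp⟩
  | succ N ih =>
    obtain ⟨n, hn, h⟩ := ih
    rw [partialSups_add_one, Pi.sup_apply]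
    rcases le_total (partialSups A N ω) (A (N + 1) ω) with h1 | h1
    · exact ⟨N + 1, le_rfl, sup_eq_right.2 h1⟩
    · exact ⟨n, hn.trans N.le_succ, by rw [sup_eq_left.2 h1, h]⟩

theorem integrable_partialSups {A : ℕ → Ω → ℝ} (hA : ∀ n, Integrable (A n) μ) (N : ℕ) :
    Integrable (partialSups A N) μ := by
  induction N with
  | zero => simpa using hA 0
  | succ N ih => rw [partialSups_add_one]; exact ih.sup (hA _)

/-- The maximal ergodic lemma for the positive operator `h ↦ E(h ∘ T | m)`. -/
theorem integral_nonneg_of_maximal (hT : MeasurePreserving T μ μ) (hm : m ≤ mΩ)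
    {A : ℕ → Ω → ℝ} {g : Ω → ℝ} (hA0 : A 0 = 0) (hA : ∀ n, Integrable (A n) μ)
    (hg : Integrable g μ) (hAm : ∀ n, Measurable (A n))
    (hrec : ∀ n, A (n + 1) =ᵐ[μ] g + μ[A n ∘ T | m]) (N : ℕ) :
    0 ≤ ∫ ω in {ω | ∃ n ≤ N, 0 < A n ω}, g ω ∂μ := by
  -- Garsia's argument: where some A_n is positive, M ≤ g + E(M ∘ T | m); elsewhere M = 0 ≤ E(M ∘ T
  -- | m). Hence M - E(M ∘ T | m) ≤ 1_E g, and the left side has integral zero.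
  set M := partialSups A N with hM
  have hMi : Integrable M μ := integrable_partialSups hA N
  have hMT := hT.integrable_comp_of_integrable hMi
  have hM0 : 0 ≤ M := fun ω => by
    have := (partialSups_spec A N ω).1 0 (Nat.zero_le _)
    simpa [hA0] using this
  have hE : MeasurableSet {ω | ∃ n ≤ N, 0 < A n ω} := by
    have : {ω | ∃ n ≤ N, 0 < A n ω} = ⋃ n, ⋃ (_ : n ≤ N), {ω | 0 < A n ω} := by ext; simp
    rw [this]
    exact MeasurableSet.iUnion fun n => MeasurableSet.iUnion fun _ =>
      measurableSet_lt measurable_const (hAm n)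
  have hmono : ∀ᵐ ω ∂μ, ∀ n, n ≤ N → (μ[A n ∘ T | m]) ω ≤ (μ[M ∘ T | m]) ω := by
    refine ae_all_iff.2 fun n => ?_
    by_cases hn : n ≤ N
    · filter_upwards [condExp_mono (m := m) (hT.integrable_comp_of_integrable (hA n)) hMT
        (Eventually.of_forall fun ω => (partialSups_spec A N (T ω)).1 n hn)] with ω h _ using h
    · exact Eventually.of_forall fun ω h => absurd h hn
  have hpos : 0 ≤ᵐ[μ] μ[M ∘ T | m] := condExp_nonneg (Eventually.of_forall fun ω => hM0 (T ω))
  have hle : (fun ω => M ω - (μ[M ∘ T | m]) ω) ≤ᵐ[μ]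
      {ω | ∃ n ≤ N, 0 < A n ω}.indicator g := by
    filter_upwards [hmono, hpos, ae_all_iff.2 hrec] with ω h1 h2 h3
    obtain ⟨hs1, n, hn, hs2⟩ := partialSups_spec A N ω
    by_cases hω : ∃ n ≤ N, 0 < A n ω
    · rw [Set.indicator_of_mem (by exact hω)]
      obtain ⟨k, hk, hk0⟩ := hω
      have hn0 : 0 < A n ω := hs2 ▸ hk0.trans_le (hs1 k hk)
      rw [hM, hs2]
      cases n with
      | zero => simp [hA0] at hn0
      | succ n =>
        rw [h3 n, Pi.add_apply]
        have := h1 n (by omega)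
        linarith
    · rw [Set.indicator_of_notMem (by exact hω)]
      push Not at hω
      have h4 := hω n hn
      have h5 : (0 : ℝ) ≤ (μ[M ∘ T | m]) ω := h2
      rw [hM, hs2]
      linarith
  have hint := integral_mono_ae (hMi.sub integrable_condExp) (hg.indicator hE) hle
  rw [integral_indicator hE] at hint
  refine le_trans (le_of_eq ?_) hint
  have h1 : ∫ ω, (M ∘ T) ω ∂μ = ∫ ω, M ω ∂μ := by
    have := integral_map (μ := μ) hT.measurable.aemeasurable (f := M)
      (by rw [hT.map_eq]; exact hMi.aestronglyMeasurable)
    rw [hT.map_eq] at this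
    exact this.symm
  rw [Pi.sub_def, integral_sub hMi integrable_condExp, integral_condExp hm, h1, sub_self]

/-- The weak type maximal inequality for averages of `E(f ∘ T^j | m)`. -/
theorem measure_exists_avg_gt_le (hT : MeasurePreserving T μ μ) (hm : m ≤ mΩ)
    (hmT : m ≤ m.comap T) {f : Ω → ℝ} (hf : Integrable f μ) (hf0 : 0 ≤ f) {c : ℝ}
    (hc : 0 < c) (N : ℕ) :
    μ {ω | ∃ n ≤ N, (n : ℝ) * c < ∑ j ∈ Finset.range n, (μ[f ∘ T^[j] | m]) ω} ≤
      ENNReal.ofReal ((∫ ω, f ω ∂μ) / c) := by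
  set a : ℕ → Ω → ℝ := fun j => μ[f ∘ T^[j] | m] with ha
  have hai : ∀ j, Integrable (a j) μ := fun j => integrable_condExp
  have ham : ∀ j, Measurable (a j) := fun j =>
    (stronglyMeasurable_condExp.mono hm).measurable
  set A : ℕ → Ω → ℝ := fun n => (∑ j ∈ Finset.range n, a j) - fun _ => (n : ℝ) * c with hA
  have hAi : ∀ n, Integrable (A n) μ := fun n =>
    (integrable_finsetSum' _ fun j _ => hai j).sub (integrable_const _)
  have hAm : ∀ n, Measurable (A n) := by
    intro n
    have : A n = fun ω => (∑ j ∈ Finset.range n, a j ω) - (n : ℝ) * c := by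
      funext ω; simp [hA]
    rw [this]
    exact (Finset.measurable_fun_sum _ fun j _ => ham j).sub_const _
  have hfj : ∀ j, Integrable (f ∘ T^[j]) μ := fun j =>
    (hT.iterate j).integrable_comp_of_integrable hf
  -- Holds because Q maps a_j to a_{j+1} and fixes constants.
  have hrec : ∀ n, A (n + 1) =ᵐ[μ] (a 0 - fun _ => c) + μ[A n ∘ T | m] := by
    intro n
    have hdec : A n ∘ T = (∑ j ∈ Finset.range n, a j ∘ T) - fun _ => (n : ℝ) * c := by
      funext ω; simp [hA]
    have h1 : ∀ᵐ ω ∂μ, ∀ j, (μ[a j ∘ T | m]) ω = a (j + 1) ω :=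
      ae_all_iff.2 fun j => condExp_condExp_comp hT hm hmT (hfj j)
    rw [hdec]
    filter_upwards [h1, condExp_sub (μ := μ) (f := ∑ j ∈ Finset.range n, a j ∘ T)
      (integrable_finsetSum' _ fun j _ => hT.integrable_comp_of_integrable (hai j))
      (integrable_const ((n : ℝ) * c)) m,
      condExp_finsetSum (s := Finset.range n) (f := fun j => a j ∘ T)
        (fun j _ => hT.integrable_comp_of_integrable (hai j)) m] with ω h2 h3 h4
    rw [Pi.add_apply, h3, Pi.sub_apply, Pi.sub_apply, h4, condExp_const hm]
    simp only [hA, Pi.sub_apply, Finset.sum_apply, h2, Finset.sum_range_succ']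
    push_cast
    ring
  have hmain := integral_nonneg_of_maximal hT hm (by funext ω; simp [hA]) hAi
    ((hai 0).sub (integrable_const c)) hAm hrec N
  have hset : {ω | ∃ n ≤ N, 0 < A n ω} =
      {ω | ∃ n ≤ N, (n : ℝ) * c < ∑ j ∈ Finset.range n, (μ[f ∘ T^[j] | m]) ω} := by
    ext ω
    simp [hA, ha]
  rw [hset] at hmain
  set E := {ω | ∃ n ≤ N, (n : ℝ) * c < ∑ j ∈ Finset.range n, (μ[f ∘ T^[j] | m]) ω} with hE
  rw [Pi.sub_def, integral_sub (hai 0).integrableOn (integrable_const c).integrableOn] at hmain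
  have h1 : ∫ ω in E, a 0 ω ∂μ ≤ ∫ ω, f ω ∂μ := by
    refine (setIntegral_le_integral (hai 0)
      (condExp_nonneg (Eventually.of_forall fun ω => hf0 _))).trans (le_of_eq ?_)
    exact integral_condExp hm
  rw [setIntegral_const, smul_eq_mul] at hmain
  rw [← ofReal_measureReal]
  refine ENNReal.ofReal_le_ofReal ?_
  rw [le_div_iff₀ hc]
  linarith

/-- The maximal function `sup_n (n⁻¹ ∑_{j<n} E(d² ∘ T^j | m))^{1/2}`. -/
noncomputable def maxFun {Ω : Type*} (m : MeasurableSpace Ω) [MeasurableSpace Ω]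
    (μ : Measure Ω) (T : Ω → Ω) (d : Ω → ℝ) (ω : Ω) : ENNReal :=
  ⨆ n : ℕ, ENNReal.ofReal √((∑ j ∈ Finset.range (n + 1),
    (μ[fun ω' => d (T^[j] ω') ^ 2 | m]) ω) / ((n : ℝ) + 1))

theorem measurable_maxFun (hm : m ≤ mΩ) (d : Ω → ℝ) : Measurable (maxFun m μ T d) := by
  refine Measurable.iSup fun n => ENNReal.measurable_ofReal.comp (Measurable.sqrt ?_)
  exact (Finset.measurable_fun_sum _ fun j _ =>
    (stronglyMeasurable_condExp.mono hm).measurable).div_const _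

theorem sum_condExp_le_maxFun (d : Ω → ℝ) (n : ℕ) (ω : Ω) :
    ENNReal.ofReal √(∑ j ∈ Finset.range n, (μ[fun ω' => d (T^[j] ω') ^ 2 | m]) ω) ≤
      ENNReal.ofReal √(n : ℝ) * maxFun m μ T d ω := by
  cases n with
  | zero => simp
  | succ n =>
    refine le_trans (le_of_eq ?_) (mul_le_mul_right (le_iSup _ n) _)
    rw [← ENNReal.ofReal_mul (Real.sqrt_nonneg _), ← Real.sqrt_mul (by positivity)]
    congr 2
    push_cast
    field_simp

/-- The ranges t ≤ b and t > b contribute at most b each. This is the layer-cake integral of a weak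
L² tail. -/
theorem lintegral_min_one_sq_div_le {b : ℝ} (hb : 0 < b) :
    ∫⁻ t in Set.Ioi (0 : ℝ), min 1 (ENNReal.ofReal (b ^ 2 / t ^ 2)) ≤ 2 * ENNReal.ofReal b := by
  rw [← Set.Ioc_union_Ioi_eq_Ioi hb.le]
  refine (lintegral_union_le _ _ _).trans ?_
  rw [two_mul]
  gcongr
  · calc ∫⁻ t in Set.Ioc (0 : ℝ) b, min 1 (ENNReal.ofReal (b ^ 2 / t ^ 2))
        ≤ ∫⁻ t in Set.Ioc (0 : ℝ) b, 1 := lintegral_mono fun t => min_le_left _ _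
      _ = ENNReal.ofReal b := by simp
  · calc ∫⁻ t in Set.Ioi b, min 1 (ENNReal.ofReal (b ^ 2 / t ^ 2))
        ≤ ∫⁻ t in Set.Ioi b, ENNReal.ofReal (b ^ 2 * t ^ (-2 : ℝ)) := by
          refine setLIntegral_mono' measurableSet_Ioi fun t ht => (min_le_right _ _).trans ?_
          rw [Real.rpow_neg (hb.trans ht).le, div_eq_mul_inv]
          norm_num
      _ = ENNReal.ofReal (∫ t in Set.Ioi b, b ^ 2 * t ^ (-2 : ℝ)) := by
          rw [ofReal_integral_eq_lintegral_ofReal]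
          · exact (integrableOn_Ioi_rpow_of_lt (by norm_num) hb).const_mul _
          · filter_upwards [ae_restrict_mem measurableSet_Ioi] with t ht
            have : 0 < t := hb.trans ht
            simp only [Pi.zero_apply]
            positivity
      _ = ENNReal.ofReal b := by
          rw [integral_const_mul, integral_Ioi_rpow_of_lt (by norm_num) hb]
          congr 1
          norm_num [Real.rpow_neg hb.le]
          field_simp

/-- The maximal function is bounded in `L¹` by the `L²` norm. -/
theorem lintegral_maxFun_le (hT : MeasurePreserving T μ μ) (hm : m ≤ mΩ)
    (hmT : m ≤ m.comap T) {d : Ω → ℝ} (hd : MemLp d 2 μ) :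
    ∫⁻ ω, maxFun m μ T d ω ∂μ ≤ 2 * eLpNorm d 2 μ := by
  set φ : ℕ → Ω → ℝ := fun n ω => √((∑ j ∈ Finset.range (n + 1),
    (μ[fun ω' => d (T^[j] ω') ^ 2 | m]) ω) / ((n : ℝ) + 1)) with hφ
  have hφm : ∀ n, Measurable (φ n) := fun n => Measurable.sqrt
    ((Finset.measurable_fun_sum _ fun j _ =>
      (stronglyMeasurable_condExp.mono hm).measurable).div_const _)
  have hPm : ∀ N, Measurable (partialSups φ N) := by
    intro N
    induction N with
    | zero => simpa using hφm 0
    | succ N ih => rw [partialSups_add_one]; exact ih.sup (hφm _)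
  have hmax : ∀ ω, maxFun m μ T d ω = ⨆ N, ENNReal.ofReal (partialSups φ N ω) := by
    intro ω
    refine le_antisymm (iSup_mono fun n => ENNReal.ofReal_le_ofReal
      ((partialSups_spec φ n ω).1 n le_rfl)) (iSup_le fun N => ?_)
    obtain ⟨n, -, hn⟩ := (partialSups_spec φ N ω).2
    rw [hn]
    exact le_iSup (fun n => ENNReal.ofReal (φ n ω)) n
  simp_rw [hmax]
  rw [lintegral_iSup (fun N => (hPm N).ennreal_ofReal) (fun N N' h ω =>
    ENNReal.ofReal_le_ofReal ((partialSups φ).monotone h ω)), eLpNorm_two_eq hd]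
  refine iSup_le fun N => ?_
  set I := ∫ ω, d ω ^ 2 ∂μ with hI
  have hI0 : 0 ≤ I := integral_nonneg fun ω => sq_nonneg _
  -- Taking b > √I keeps b positive even when I = 0; b decreases to √I at the end.
  have hb : ∀ b : ℝ, √I < b → ∫⁻ ω, ENNReal.ofReal (partialSups φ N ω) ∂μ ≤
      2 * ENNReal.ofReal b := by
    intro b hb
    have hb0 : 0 < b := (Real.sqrt_nonneg I).trans_lt hb
    have hIb : I ≤ b ^ 2 := (Real.sqrt_le_left hb0.le).1 hb.le
    rw [lintegral_eq_lintegral_meas_lt μ (Eventually.of_forall fun ω => by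
      obtain ⟨n, -, hn⟩ := (partialSups_spec φ N ω).2
      rw [Pi.zero_apply, hn]
      exact Real.sqrt_nonneg _) (hPm N).aemeasurable]
    refine le_trans (setLIntegral_mono' measurableSet_Ioi fun t ht => ?_)
      (lintegral_min_one_sq_div_le hb0)
    have ht : 0 < t := ht
    refine le_min prob_le_one ?_
    -- The weak type inequality is applied to d² at level t², giving a tail I / t².
    refine (measure_mono ?_).trans ((measure_exists_avg_gt_le hT hm hmT hd.integrable_sq
      (fun ω => sq_nonneg _) (c := t ^ 2) (by positivity) (N + 1)).trans
      (ENNReal.ofReal_le_ofReal (by gcongr)))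
    intro ω hω
    obtain ⟨n, hn, hn'⟩ := (partialSups_spec φ N ω).2
    have hω : t < partialSups φ N ω := hω
    rw [hn', hφ, Real.lt_sqrt ht.le, lt_div_iff₀ (by positivity)] at hω
    refine ⟨n + 1, by omega, ?_⟩
    push_cast
    rw [mul_comm]
    exact hω
  have hcont : Tendsto (fun b : ℝ => 2 * ENNReal.ofReal b) (𝓝[>] √I)
      (𝓝 (2 * ENNReal.ofReal √I)) :=
    (ENNReal.Tendsto.const_mul (ENNReal.continuous_ofReal.tendsto _) (Or.inr (by norm_num))).mono_left
      nhdsWithin_le_nhds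
  exact ge_of_tendsto hcont (eventually_mem_nhdsWithin.mono fun b h => hb b h)

end Maximal

/-! ### Almost sure convergence from small dominating functions -/

section Convergence

variable {Ω : Type*} {m : MeasurableSpace Ω} [mΩ : MeasurableSpace Ω] {μ : Measure Ω}
  [IsProbabilityMeasure μ] {T : Ω → Ω}

/-- If `q n` is asymptotically dominated by functions of arbitrarily small integral, it tends to
zero almost everywhere. -/
theorem ae_tendsto_zero_of_forall_exists_le {q : ℕ → Ω → ENNReal}
    (h : ∀ ε : ℝ, 0 < ε → ∃ (W : Ω → ENNReal) (r : ℕ → Ω → ENNReal), Measurable W ∧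
      ∫⁻ ω, W ω ∂μ ≤ ENNReal.ofReal ε ∧
      ∀ᵐ ω ∂μ, Tendsto (fun n => r n ω) atTop (𝓝 0) ∧ ∀ᶠ n in atTop, q n ω ≤ W ω + r n ω) :
    ∀ᵐ ω ∂μ, Tendsto (fun n => q n ω) atTop (𝓝 0) := by
  choose W r hW hWi hr using fun k : ℕ => h (1 / ((k : ℝ) + 1)) (by positivity)
  -- No summability of the W k is needed: almost everywhere, some W k is as small as desired.
  have hzero : ∫⁻ ω, ⨅ k, W k ω ∂μ = 0 := by
    refine le_antisymm (ge_of_tendsto' (x := atTop)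
      (f := fun k : ℕ => ENNReal.ofReal (1 / ((k : ℝ) + 1))) ?_ fun k =>
      (lintegral_mono fun ω => iInf_le _ k).trans (hWi k)) zero_le
    have := (ENNReal.continuous_ofReal.tendsto 0).comp
      (tendsto_one_div_add_atTop_nhds_zero_nat (𝕜 := ℝ))
    simpa [Function.comp_def] using this
  rw [lintegral_eq_zero_iff (Measurable.iInf hW)] at hzero
  filter_upwards [hzero, ae_all_iff.2 hr] with ω h0 h1
  rw [ENNReal.tendsto_nhds_zero]
  intro ε hε
  have h0 : ⨅ k, W k ω = 0 := h0
  have hε2 : 0 < ε / 2 := ENNReal.half_pos hε.ne'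
  obtain ⟨k, hk⟩ := iInf_lt_iff.1 (h0.trans_lt hε2)
  filter_upwards [(h1 k).2, ENNReal.tendsto_nhds_zero.1 (h1 k).1 _ hε2] with n h2 h3
  exact h2.trans ((add_le_add hk.le h3).trans (ENNReal.add_halves ε).le)

/-- A single nonnegative term is bounded by the sum of the first n + 1 terms. -/
theorem condNorm_comp_iterate_le (d : Ω → ℝ) :
    ∀ᵐ ω ∂μ, ∀ n : ℕ, condNorm m μ (d ∘ T^[n]) ω ≤
      ENNReal.ofReal √((n + 1 : ℕ) : ℝ) * maxFun m μ T d ω := by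
  have h : ∀ᵐ ω ∂μ, ∀ n : ℕ, 0 ≤ (μ[fun ω' => d (T^[n] ω') ^ 2 | m]) ω :=
    ae_all_iff.2 fun n => condExp_nonneg (Eventually.of_forall fun ω => sq_nonneg _)
  filter_upwards [h] with ω h n
  refine le_trans (ENNReal.ofReal_le_ofReal (Real.sqrt_le_sqrt ?_))
    (sum_condExp_le_maxFun d (n + 1) ω)
  rw [Finset.sum_range_succ]
  exact le_add_of_nonneg_left (Finset.sum_nonneg fun j _ => h j)

theorem tendsto_div_ofReal_sqrt {c : ENNReal} (hc : c ≠ ⊤) :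
    Tendsto (fun n : ℕ => c / ENNReal.ofReal √(n : ℝ)) atTop (𝓝 0) := by
  have h : Tendsto (fun n : ℕ => ENNReal.ofReal √(n : ℝ)) atTop (𝓝 ⊤) :=
    ENNReal.tendsto_ofReal_nhds_top.2
      (Real.tendsto_sqrt_atTop.comp tendsto_natCast_atTop_atTop)
  simpa using ENNReal.Tendsto.const_div h (Or.inr hc)

theorem condNorm_le_of_abs_le (hm : m ≤ mΩ) {g : Ω → ℝ} {K : ℝ} (hK : 0 ≤ K)
    (hg : ∀ᵐ ω ∂μ, |g ω| ≤ K) (hgL : MemLp g 2 μ) :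
    ∀ᵐ ω ∂μ, condNorm m μ g ω ≤ ENNReal.ofReal K := by
  have h := condExp_mono (m := m) hgL.integrable_sq (integrable_const (K ^ 2))
    (hg.mono fun ω h => by
      have := abs_le.1 h
      exact sq_le_sq' this.1 this.2)
  rw [condExp_const hm] at h
  filter_upwards [h] with ω h
  exact ENNReal.ofReal_le_ofReal (Real.sqrt_le_iff.2 ⟨hK, h⟩)

theorem ofReal_sqrt_pos {n : ℕ} (hn : n ≠ 0) : ENNReal.ofReal √(n : ℝ) ≠ 0 := by
  have : (0 : ℝ) < n := by exact_mod_cast Nat.pos_of_ne_zero hn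
  simpa using this

/-- For `g ∈ L²`, `E(g² ∘ T^n | m) = o(n)` almost surely. -/
theorem condNorm_comp_iterate_isLittleO (hT : MeasurePreserving T μ μ) (hm : m ≤ mΩ)
    (hmT : m ≤ m.comap T) {g : Ω → ℝ} (hg : MemLp g 2 μ) :
    ∀ᵐ ω ∂μ, Tendsto (fun n : ℕ => condNorm m μ (g ∘ T^[n]) ω / ENNReal.ofReal √(n : ℝ))
      atTop (𝓝 0) := by
  refine ae_tendsto_zero_of_forall_exists_le fun ε hε => ?_
  -- The simple part is bounded and vanishes after division by √n. For the rest, √(n+1) ≤ 2√n costs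
  -- a factor 2 and the maximal inequality another 2, whence ε / 4.
  obtain ⟨g₁, hg₁, hg₁L⟩ := hg.exists_simpleFunc_eLpNorm_sub_lt (by norm_num)
    (ε := ENNReal.ofReal (ε / 4)) (by simpa using hε)
  obtain ⟨K, hK⟩ := g₁.exists_forall_norm_le
  have hK' : ∀ ω, |g₁ ω| ≤ max K 0 := fun ω => (hK ω).trans (le_max_left _ _)
  have hg₂ := hg.sub hg₁L
  refine ⟨fun ω => 2 * maxFun m μ T (g - ⇑g₁) ω,
    fun n _ => ENNReal.ofReal (max K 0) / ENNReal.ofReal √(n : ℝ),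
    (measurable_maxFun hm _).const_mul _, ?_, ?_⟩
  · rw [lintegral_const_mul _ (measurable_maxFun hm _)]
    calc 2 * ∫⁻ ω, maxFun m μ T (g - ⇑g₁) ω ∂μ ≤ 2 * (2 * ENNReal.ofReal (ε / 4)) := by
          gcongr
          exact (lintegral_maxFun_le hT hm hmT hg₂).trans (by gcongr)
      _ = ENNReal.ofReal ε := by
          rw [← ENNReal.ofReal_ofNat 2, ← ENNReal.ofReal_mul (by norm_num),
            ← ENNReal.ofReal_mul (by norm_num)]
          congr 1
          ring
  · have hK2 : ∀ᵐ ω ∂μ, ∀ n : ℕ, condNorm m μ (g₁ ∘ T^[n]) ω ≤ ENNReal.ofReal (max K 0) :=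
      ae_all_iff.2 fun n => condNorm_le_of_abs_le hm (le_max_right _ _)
        (Eventually.of_forall fun ω => hK' _) (hg₁L.comp_measurePreserving (hT.iterate n))
    have hadd : ∀ᵐ ω ∂μ, ∀ n : ℕ, condNorm m μ (g ∘ T^[n]) ω ≤
        condNorm m μ ((g - ⇑g₁) ∘ T^[n]) ω + condNorm m μ (g₁ ∘ T^[n]) ω := by
      refine ae_all_iff.2 fun n => ?_
      have := condNorm_add_le (m := m) (hg₂.comp_measurePreserving (hT.iterate n))
        (hg₁L.comp_measurePreserving (hT.iterate n))
      have heq : (g - ⇑g₁) ∘ T^[n] + g₁ ∘ T^[n] = g ∘ T^[n] := by funext; simp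
      rwa [heq] at this
    filter_upwards [hK2, hadd, condNorm_comp_iterate_le (m := m) (μ := μ) (T := T) (g - ⇑g₁)]
      with ω h1 h2 h3
    refine ⟨tendsto_div_ofReal_sqrt ENNReal.ofReal_ne_top, ?_⟩
    filter_upwards [eventually_ge_atTop 1] with n hn
    rw [ENNReal.div_le_iff (ofReal_sqrt_pos (by omega)) ENNReal.ofReal_ne_top, add_mul,
      ENNReal.div_mul_cancel (ofReal_sqrt_pos (by omega)) ENNReal.ofReal_ne_top]
    refine (h2 n).trans (add_le_add ((h3 n).trans ?_) (h1 n))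
    rw [mul_comm (2 : ENNReal), mul_assoc, mul_comm (maxFun _ _ _ _ _)]
    gcongr
    rw [← ENNReal.ofReal_ofNat 2, ← ENNReal.ofReal_mul (by norm_num)]
    refine ENNReal.ofReal_le_ofReal (Real.sqrt_le_iff.2 ⟨by positivity, ?_⟩)
    rw [mul_pow, Real.sq_sqrt (by positivity)]
    have : (1 : ℝ) ≤ n := by exact_mod_cast hn
    push_cast
    linarith

end Convergence

/-! ### Dyadic chaining and the maximal inequality for sums -/

section Dyadic

/-- Halving recursions with square root increments are controlled by a dyadic series. -/
theorem le_sqrt_mul_tsum_of_halving {u : ℕ → ℕ → ENNReal} {γ : ℕ → ENNReal}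
    (h0 : ∀ k, u k 0 = 0)
    (hrec : ∀ k n, u k n ≤ u (k + 1) (n / 2) + ENNReal.ofReal √(n : ℝ) * γ k) (n : ℕ) :
    u 0 n ≤ ENNReal.ofReal √(n : ℝ) * ∑' l, γ l / ENNReal.ofReal √(2 ^ l) := by
  -- The quantity n·2^k does not increase under (n, k) ↦ (⌊n/2⌋, k+1), so the same prefactor serves
  -- at every level.
  have key : ∀ n k : ℕ, u k n ≤ ENNReal.ofReal √(n * 2 ^ k : ℝ) *
      ∑' l, γ (l + k) / ENNReal.ofReal √(2 ^ (l + k)) := by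
    intro n
    induction n using Nat.strong_induction_on with
    | _ n ih =>
      intro k
      rcases Nat.eq_zero_or_pos n with rfl | hn
      · simp [h0]
      rw [tsum_eq_zero_add' ENNReal.summable, mul_add, add_comm]
      refine (hrec k n).trans (add_le_add ((ih (n / 2) (by omega) (k + 1)).trans ?_) ?_)
      · simp_rw [add_right_comm _ 1 k, add_assoc _ k 1]
        refine mul_le_mul_left (ENNReal.ofReal_le_ofReal (Real.sqrt_le_sqrt ?_)) _
        have : ((n / 2 : ℕ) : ℝ) ≤ n / 2 := Nat.cast_div_le
        rw [pow_succ]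
        have h2 : (0 : ℝ) < 2 ^ k := by positivity
        nlinarith
      · rw [zero_add, Real.sqrt_mul (by positivity), ENNReal.ofReal_mul (by positivity), mul_assoc,
          ENNReal.mul_div_cancel (by simp) ENNReal.ofReal_ne_top]
  simpa using key n 0

variable {Ω : Type*} {m : MeasurableSpace Ω} [mΩ : MeasurableSpace Ω] {μ : Measure Ω}
  [IsProbabilityMeasure μ] {T : Ω → Ω}

theorem condNorm_sum_iterate_le (hT : MeasurePreserving T μ μ) (hm : m ≤ mΩ)
    (hmT : m ≤ m.comap T) {d : Ω → ℝ} (hd : MemLp d 2 μ)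
    (hdm : StronglyMeasurable[m.comap T] d) (h0 : μ[d | m] =ᵐ[μ] 0) :
    ∀ᵐ ω ∂μ, ∀ n : ℕ, condNorm m μ (fun ω => ∑ j ∈ Finset.range n, d (T^[j] ω)) ω ≤
      ENNReal.ofReal √(n : ℝ) * maxFun m μ T d ω := by
  refine ae_all_iff.2 fun n => ?_
  filter_upwards [condExp_sq_sum_iterate hT hm hmT hd hdm h0 n] with ω h
  rw [condNorm, h]
  exact sum_condExp_le_maxFun d n ω

theorem integral_comp_measurePreserving {S : Ω → Ω} (hS : MeasurePreserving S μ μ) {g : Ω → ℝ}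
    (hg : Integrable g μ) : ∫ ω, g (S ω) ∂μ = ∫ ω, g ω ∂μ := by
  have := integral_map (μ := μ) hS.measurable.aemeasurable (f := g)
    (by rw [hS.map_eq]; exact hg.aestronglyMeasurable)
  rw [hS.map_eq] at this
  exact this.symm

/-- Integrating the conditional Pythagoras identity gives n equal terms by stationarity. -/
theorem eLpNorm_sum_iterate (hT : MeasurePreserving T μ μ) (hm : m ≤ mΩ)
    (hmT : m ≤ m.comap T) {d : Ω → ℝ} (hd : MemLp d 2 μ)
    (hdm : StronglyMeasurable[m.comap T] d) (h0 : μ[d | m] =ᵐ[μ] 0) (n : ℕ) :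
    eLpNorm (fun ω => ∑ j ∈ Finset.range n, d (T^[j] ω)) 2 μ =
      ENNReal.ofReal √(n : ℝ) * eLpNorm d 2 μ := by
  rw [eLpNorm_two_eq (memLp_sum_iterate hT hd n), eLpNorm_two_eq hd,
    ← ENNReal.ofReal_mul (Real.sqrt_nonneg _), ← Real.sqrt_mul (by positivity)]
  congr 2
  rw [← integral_condExp hm, integral_congr_ae (condExp_sq_sum_iterate hT hm hmT hd hdm h0 n),
    integral_finsetSum _ fun j _ => integrable_condExp]
  simp_rw [integral_condExp hm]
  rw [Finset.sum_congr rfl fun j _ => integral_comp_measurePreserving (hT.iterate j)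
    hd.integrable_sq]
  simp

/-- The martingale difference part `f - E(f | m)`. -/
noncomputable def innov {Ω : Type*} (m : MeasurableSpace Ω) [MeasurableSpace Ω]
    (μ : Measure Ω) (f : Ω → ℝ) : Ω → ℝ := f - μ[f | m]

theorem memLp_innov {f : Ω → ℝ} (hf : MemLp f 2 μ) : MemLp (innov m μ f) 2 μ :=
  hf.sub (hf.condExp one_le_two)

theorem eLpNorm_innov_le {f : Ω → ℝ} (hf : MemLp f 2 μ) :
    eLpNorm (innov m μ f) 2 μ ≤ 2 * eLpNorm f 2 μ := by
  refine (eLpNorm_sub_le hf.aestronglyMeasurable (hf.condExp one_le_two).aestronglyMeasurable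
    one_le_two).trans ?_
  rw [two_mul]
  gcongr
  exact eLpNorm_condExp_le_eLpNorm f one_le_two

theorem condExp_innov (hm : m ≤ mΩ) {f : Ω → ℝ} (hf : Integrable f μ) :
    μ[innov m μ f | m] =ᵐ[μ] 0 := by
  filter_upwards [condExp_sub hf (integrable_condExp (m := m) (f := f)) m] with ω h
  rw [innov, h, Pi.sub_apply,
    condExp_of_stronglyMeasurable hm stronglyMeasurable_condExp integrable_condExp]
  simp

theorem stronglyMeasurable_innov (hmT : m ≤ m.comap T) {f : Ω → ℝ}
    (hf : StronglyMeasurable[m.comap T] f) : StronglyMeasurable[m.comap T] (innov m μ f) :=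
  hf.sub (stronglyMeasurable_condExp.mono hmT)

/-- The sum `z ∘ T + ⋯ + z ∘ T^n`. -/
def shiftSum {Ω : Type*} (T : Ω → Ω) (z : Ω → ℝ) (n : ℕ) : Ω → ℝ :=
  fun ω => ∑ j ∈ Finset.range n, z (T^[j + 1] ω)

theorem memLp_shiftSum (hT : MeasurePreserving T μ μ) {z : Ω → ℝ} (hz : MemLp z 2 μ) (n : ℕ) :
    MemLp (shiftSum T z n) 2 μ :=
  memLp_finsetSum _ fun j _ => hz.comp_measurePreserving (hT.iterate (j + 1))

theorem shiftSum_add (z : Ω → ℝ) (p n : ℕ) :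
    shiftSum T z (p + n) = shiftSum T z p + shiftSum T z n ∘ T^[p] := by
  funext ω
  simp only [shiftSum, Finset.sum_range_add, Pi.add_apply, Function.comp_apply,
    ← Function.iterate_add_apply]
  congr 1
  refine Finset.sum_congr rfl fun j _ => ?_
  rw [show p + j + 1 = j + 1 + p by ring]

/-- The dyadic conditional sums `E(z ∘ T + ⋯ + z ∘ T^{2^k} | m)`. -/
noncomputable def dyadicCond {Ω : Type*} (m : MeasurableSpace Ω) [MeasurableSpace Ω]
    (μ : Measure Ω) (T : Ω → Ω) (z : Ω → ℝ) (k : ℕ) : Ω → ℝ :=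
  μ[shiftSum T z (2 ^ k) | m]

theorem memLp_dyadicCond (hT : MeasurePreserving T μ μ) {z : Ω → ℝ} (hz : MemLp z 2 μ) (k : ℕ) :
    MemLp (dyadicCond m μ T z k) 2 μ :=
  (memLp_shiftSum hT hz _).condExp one_le_two

/-- The chaining step: the second block of length 2^k has conditional expectation E(S_{2^k} ∘
T^{2^k} | m), which completes the first block to level k+1. What remains is a martingale difference.
-/
theorem dyadicCond_succ (hT : MeasurePreserving T μ μ) (hm : m ≤ mΩ) (hmT : m ≤ m.comap T)
    {z : Ω → ℝ} (hz : MemLp z 2 μ) (k : ℕ) :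
    dyadicCond m μ T z k + dyadicCond m μ T z k ∘ T^[2 ^ k] =ᵐ[μ]
      dyadicCond m μ T z (k + 1) + innov m μ (dyadicCond m μ T z k ∘ T^[2 ^ k]) := by
  have hS := (memLp_shiftSum hT hz (2 ^ k)).integrable one_le_two
  have hTk := hT.iterate (2 ^ k)
  have h1 := condExp_add (μ := μ) hS (hTk.integrable_comp_of_integrable hS) m
  have h2 := condExp_condExp_comp hTk hm (le_comap_iterate hmT _) hS
  filter_upwards [h1, h2] with ω h1 h2
  simp only [Pi.add_apply, innov, Pi.sub_apply, dyadicCond] at h1 h2 ⊢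
  rw [pow_succ, mul_two, shiftSum_add, h1, h2]
  ring

/-- Sums of the level `k` dyadic conditional sums along steps of length `2^k`. -/
noncomputable def levelSum {Ω : Type*} (m : MeasurableSpace Ω) [MeasurableSpace Ω]
    (μ : Measure Ω) (T : Ω → Ω) (z : Ω → ℝ) (k n : ℕ) : Ω → ℝ :=
  fun ω => ∑ i ∈ Finset.range n, dyadicCond m μ T z k ((T^[2 ^ k])^[i] ω)

theorem memLp_levelSum (hT : MeasurePreserving T μ μ) {z : Ω → ℝ} (hz : MemLp z 2 μ) (k n : ℕ) :
    MemLp (levelSum m μ T z k n) 2 μ :=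
  memLp_sum_iterate (hT.iterate _) (memLp_dyadicCond hT hz k) n

theorem levelSum_two_mul (hT : MeasurePreserving T μ μ) (hm : m ≤ mΩ) (hmT : m ≤ m.comap T)
    {z : Ω → ℝ} (hz : MemLp z 2 μ) (k n : ℕ) :
    levelSum m μ T z k (2 * n) =ᵐ[μ] levelSum m μ T z (k + 1) n +
      fun ω => ∑ i ∈ Finset.range n,
        innov m μ (dyadicCond m μ T z k ∘ T^[2 ^ k]) ((T^[2 ^ (k + 1)])^[i] ω) := by
  have h : ∀ᵐ ω ∂μ, ∀ i : ℕ, (dyadicCond m μ T z k + dyadicCond m μ T z k ∘ T^[2 ^ k])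
      ((T^[2 ^ (k + 1)])^[i] ω) = (dyadicCond m μ T z (k + 1) +
        innov m μ (dyadicCond m μ T z k ∘ T^[2 ^ k])) ((T^[2 ^ (k + 1)])^[i] ω) :=
    ae_all_iff.2 fun i => ((hT.iterate _).iterate i).quasiMeasurePreserving.ae_eq_comp
      (dyadicCond_succ hT hm hmT hz k)
  filter_upwards [h] with ω h
  simp only [levelSum, Pi.add_apply, ← Finset.sum_add_distrib]
  simp only [Pi.add_apply] at h
  simp_rw [← h]
  induction n with
  | zero => simp
  | succ n ih =>
    rw [Finset.sum_range_succ, ← ih, Nat.mul_succ, Finset.sum_range_succ, Finset.sum_range_succ,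
      add_assoc]
    simp only [Function.comp_apply, ← Function.iterate_mul, ← Function.iterate_add_apply]
    congr 3 <;> ring_nf

/-- Consecutive terms are paired; an odd n leaves its last term, of index n - 1, unpaired. -/
theorem levelSum_halving (hT : MeasurePreserving T μ μ) (hm : m ≤ mΩ) (hmT : m ≤ m.comap T)
    {z : Ω → ℝ} (hz : MemLp z 2 μ) (k n : ℕ) :
    levelSum m μ T z k n =ᵐ[μ] levelSum m μ T z (k + 1) (n / 2) +
      (fun ω => ∑ i ∈ Finset.range (n / 2),
        innov m μ (dyadicCond m μ T z k ∘ T^[2 ^ k]) ((T^[2 ^ (k + 1)])^[i] ω)) +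
      (if n % 2 = 0 then 0 else dyadicCond m μ T z k ∘ (T^[2 ^ k])^[n - 1]) := by
  filter_upwards [levelSum_two_mul hT hm hmT hz k (n / 2)] with ω h
  rw [Pi.add_apply, ← h]
  split_ifs with hn
  · rw [show 2 * (n / 2) = n by omega]; simp
  · conv_lhs => rw [show n = 2 * (n / 2) + 1 by omega]
    simp only [levelSum, Finset.sum_range_succ, Function.comp_apply]
    rw [show 2 * (n / 2) = n - 1 by omega]

theorem shiftSum_eq_levelSum_add (z : Ω → ℝ) (n : ℕ) :
    shiftSum T z n = levelSum m μ T z 0 n +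
      fun ω => ∑ j ∈ Finset.range n, innov m μ (z ∘ T) (T^[j] ω) := by
  have h : shiftSum T z (2 ^ 0) = z ∘ T := by funext; simp [shiftSum]
  funext ω
  simp only [levelSum, dyadicCond, h, innov, Pi.add_apply, ← Finset.sum_add_distrib]
  refine Finset.sum_congr rfl fun j _ => ?_
  simp [-Function.iterate_succ, Function.iterate_succ_apply']

/-- The dyadic form of the Maxwell–Woodroofe norm. -/
noncomputable def dyadicNorm {Ω : Type*} (m : MeasurableSpace Ω) [MeasurableSpace Ω]
    (μ : Measure Ω) (T : Ω → Ω) (z : Ω → ℝ) : ENNReal :=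
  eLpNorm z 2 μ + ∑' k, eLpNorm (dyadicCond m μ T z k) 2 μ / ENNReal.ofReal √(2 ^ k)

/-- This adaptedness makes the level-k innovations martingale differences for the map T^{2^{k+1}}.
-/
theorem stronglyMeasurable_level (hmT : m ≤ m.comap T) (z : Ω → ℝ) (k : ℕ) :
    StronglyMeasurable[m.comap T^[2 ^ (k + 1)]] (dyadicCond m μ T z k ∘ T^[2 ^ k]) := by
  have h : StronglyMeasurable[m.comap T^[2 ^ k]] (dyadicCond m μ T z k ∘ T^[2 ^ k]) :=
    stronglyMeasurable_comp_comap stronglyMeasurable_condExp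
  refine h.mono ?_
  rw [pow_succ, mul_two, Function.iterate_add, ← MeasurableSpace.comap_comp]
  exact MeasurableSpace.comap_mono (le_comap_iterate hmT _)

/-- The conditional maximal inequality under the dyadic Maxwell–Woodroofe norm. -/
theorem exists_condNorm_shiftSum_le (hT : MeasurePreserving T μ μ) (hm : m ≤ mΩ)
    (hmT : m ≤ m.comap T) {z : Ω → ℝ} (hz : MemLp z 2 μ) (hzm : StronglyMeasurable[m] z) :
    ∃ Ψ : Ω → ENNReal, Measurable Ψ ∧ ∫⁻ ω, Ψ ω ∂μ ≤ 6 * dyadicNorm m μ T z ∧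
      ∀ᵐ ω ∂μ, ∀ n : ℕ, condNorm m μ (shiftSum T z n) ω ≤ ENNReal.ofReal √(n : ℝ) * Ψ ω := by
  set Y := dyadicCond m μ T z with hY
  have hYL : ∀ k, MemLp (Y k) 2 μ := memLp_dyadicCond hT hz
  have hYT : ∀ k, MemLp (Y k ∘ T^[2 ^ k]) 2 μ := fun k =>
    (hYL k).comp_measurePreserving (hT.iterate _)
  have hzT : MemLp (z ∘ T) 2 μ := hz.comp_measurePreserving hT
  set γ : ℕ → Ω → ENNReal := fun k ω =>
    maxFun m μ T^[2 ^ (k + 1)] (innov m μ (Y k ∘ T^[2 ^ k])) ω + maxFun m μ T^[2 ^ k] (Y k) ω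
    with hγ
  have hγm : ∀ k, Measurable (γ k) := fun k =>
    (measurable_maxFun hm _).add (measurable_maxFun hm _)
  -- Each level contributes a martingale and an unpaired term. Their maximal functions have
  -- integrals at most 2·2‖Y_k‖ (an innovation at most doubles the norm) and 2‖Y_k‖, whence the
  -- constant 6.
  refine ⟨fun ω => maxFun m μ T (innov m μ (z ∘ T)) ω +
    ∑' k, γ k ω / ENNReal.ofReal √(2 ^ k), ?_, ?_, ?_⟩
  · exact (measurable_maxFun hm _).add (Measurable.tsum fun k => (hγm k).div_const _)
  · rw [lintegral_add_left (measurable_maxFun hm _),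
      lintegral_tsum fun k => ((hγm k).div_const _).aemeasurable, dyadicNorm, mul_add,
      ← ENNReal.tsum_mul_left]
    gcongr with k
    · calc _ ≤ 2 * (2 * eLpNorm (z ∘ T) 2 μ) :=
            (lintegral_maxFun_le hT hm hmT (memLp_innov hzT)).trans
              (by gcongr; exact eLpNorm_innov_le hzT)
        _ = 4 * eLpNorm z 2 μ := by
            rw [eLpNorm_comp_measurePreserving hz.aestronglyMeasurable hT, ← mul_assoc]; norm_num
        _ ≤ 6 * eLpNorm z 2 μ := by gcongr; norm_num
    · simp_rw [div_eq_mul_inv]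
      rw [lintegral_mul_const _ (hγm k), ← mul_assoc]
      gcongr
      rw [lintegral_add_left (measurable_maxFun hm _)]
      calc _ ≤ 2 * (2 * eLpNorm (Y k ∘ T^[2 ^ k]) 2 μ) + 2 * eLpNorm (Y k) 2 μ :=
            add_le_add ((lintegral_maxFun_le (hT.iterate _) hm (le_comap_iterate hmT _)
              (memLp_innov (hYT k))).trans (by gcongr; exact eLpNorm_innov_le (hYT k)))
              (lintegral_maxFun_le (hT.iterate _) hm (le_comap_iterate hmT _) (hYL k))
        _ = 6 * eLpNorm (Y k) 2 μ := by
            rw [eLpNorm_comp_measurePreserving (hYL k).aestronglyMeasurable (hT.iterate _)]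
            ring
  · have hmart : ∀ᵐ ω ∂μ, ∀ k n : ℕ, condNorm m μ (fun ω => ∑ i ∈ Finset.range n,
        innov m μ (Y k ∘ T^[2 ^ k]) ((T^[2 ^ (k + 1)])^[i] ω)) ω ≤ ENNReal.ofReal √(n : ℝ) *
        maxFun m μ T^[2 ^ (k + 1)] (innov m μ (Y k ∘ T^[2 ^ k])) ω :=
      ae_all_iff.2 fun k => condNorm_sum_iterate_le (hT.iterate _) hm (le_comap_iterate hmT _)
        (memLp_innov (hYT k)) (stronglyMeasurable_innov (le_comap_iterate hmT _)
          (stronglyMeasurable_level hmT z k))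
        (condExp_innov hm ((hYT k).integrable one_le_two))
    have hodd : ∀ᵐ ω ∂μ, ∀ k n : ℕ, condNorm m μ (Y k ∘ (T^[2 ^ k])^[n]) ω ≤
        ENNReal.ofReal √((n + 1 : ℕ) : ℝ) * maxFun m μ T^[2 ^ k] (Y k) ω :=
      ae_all_iff.2 fun k => condNorm_comp_iterate_le (Y k)
    have hmartL : ∀ k n, MemLp (fun ω => ∑ i ∈ Finset.range n,
        innov m μ (Y k ∘ T^[2 ^ k]) ((T^[2 ^ (k + 1)])^[i] ω)) 2 μ := fun k n =>
      memLp_sum_iterate (hT.iterate _) (memLp_innov (hYT k)) n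
    have hoddL : ∀ k n, MemLp (if n % 2 = 0 then (0 : Ω → ℝ) else Y k ∘ (T^[2 ^ k])^[n - 1]) 2 μ := by
      intro k n
      split_ifs
      · exact MemLp.zero
      · exact (hYL k).comp_measurePreserving ((hT.iterate _).iterate _)
    have hsum : ∀ᵐ ω ∂μ, ∀ k n : ℕ, condNorm m μ (levelSum m μ T z k n) ω ≤
        condNorm m μ (levelSum m μ T z (k + 1) (n / 2)) ω +
        condNorm m μ (fun ω => ∑ i ∈ Finset.range (n / 2),
          innov m μ (Y k ∘ T^[2 ^ k]) ((T^[2 ^ (k + 1)])^[i] ω)) ω +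
        condNorm m μ (if n % 2 = 0 then (0 : Ω → ℝ) else Y k ∘ (T^[2 ^ k])^[n - 1]) ω := by
      refine ae_all_iff.2 fun k => ae_all_iff.2 fun n => ?_
      filter_upwards [condNorm_congr (m := m) (levelSum_halving hT hm hmT hz k n),
        condNorm_add_le (m := m) ((memLp_levelSum (m := m) hT hz (k + 1) (n / 2)).add
          (hmartL k (n / 2))) (hoddL k n),
        condNorm_add_le (m := m) (memLp_levelSum (m := m) hT hz (k + 1) (n / 2))
          (hmartL k (n / 2))] with ω h1 h2 h3
      rw [h1]
      exact h2.trans (by gcongr)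
    have hzero : ∀ ω, condNorm m μ (0 : Ω → ℝ) ω = 0 := by
      intro ω
      have : (fun ω' => (0 : Ω → ℝ) ω' ^ 2) = (0 : Ω → ℝ) := by funext; simp
      rw [condNorm, this, condExp_zero]
      simp
    have hfirst : ∀ᵐ ω ∂μ, ∀ n : ℕ, condNorm m μ (shiftSum T z n) ω ≤
        condNorm m μ (levelSum m μ T z 0 n) ω +
        condNorm m μ (fun ω => ∑ j ∈ Finset.range n, innov m μ (z ∘ T) (T^[j] ω)) ω := by
      refine ae_all_iff.2 fun n => ?_
      rw [shiftSum_eq_levelSum_add (m := m) (μ := μ) z n]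
      exact condNorm_add_le (memLp_levelSum hT hz 0 n) (memLp_sum_iterate hT (memLp_innov hzT) n)
    filter_upwards [hmart, hodd, hsum, hfirst, condNorm_sum_iterate_le hT hm hmT
      (memLp_innov hzT) (stronglyMeasurable_innov hmT (stronglyMeasurable_comp_comap hzm))
      (condExp_innov hm (hzT.integrable one_le_two))] with ω h1 h2 h3 h4 h5 n
    refine (h4 n).trans ?_
    rw [mul_add, add_comm]
    refine add_le_add (h5 n) ?_
    refine le_sqrt_mul_tsum_of_halving (u := fun k n => condNorm m μ (levelSum m μ T z k n) ω)
      (γ := fun k => γ k ω) (fun k => ?_) (fun k n => (h3 k n).trans ?_) n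
    · have : levelSum m μ T z k 0 = 0 := by funext; simp [levelSum]
      simp only [this, hzero]
    · rw [add_assoc, hγ, mul_add]
      gcongr
      · refine (h1 k (n / 2)).trans ?_
        gcongr
        exact Nat.div_le_self n 2
      · split_ifs with hn
        · rw [hzero]; exact zero_le
        -- For odd n, the unpaired index n - 1 gives exactly the factor √n.
        · have := h2 k (n - 1)
          rwa [show n - 1 + 1 = n by omega] at this

/-- The `L²` bound for sums under the dyadic Maxwell–Woodroofe norm. -/
theorem eLpNorm_shiftSum_le (hT : MeasurePreserving T μ μ) (hm : m ≤ mΩ)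
    (hmT : m ≤ m.comap T) {z : Ω → ℝ} (hz : MemLp z 2 μ) (hzm : StronglyMeasurable[m] z) (n : ℕ) :
    eLpNorm (shiftSum T z n) 2 μ ≤ ENNReal.ofReal √(n : ℝ) * (3 * dyadicNorm m μ T z) := by
  set Y := dyadicCond m μ T z with hY
  have hYL : ∀ k, MemLp (Y k) 2 μ := memLp_dyadicCond hT hz
  have hYT : ∀ k, MemLp (Y k ∘ T^[2 ^ k]) 2 μ := fun k =>
    (hYL k).comp_measurePreserving (hT.iterate _)
  have hzT : MemLp (z ∘ T) 2 μ := hz.comp_measurePreserving hT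
  have hrec : ∀ k n : ℕ, eLpNorm (levelSum m μ T z k n) 2 μ ≤
      eLpNorm (levelSum m μ T z (k + 1) (n / 2)) 2 μ +
        ENNReal.ofReal √(n : ℝ) * (3 * eLpNorm (Y k) 2 μ) := by
    intro k n
    have hmartL := memLp_sum_iterate (hT.iterate (2 ^ (k + 1))) (memLp_innov (m := m) (hYT k))
      (n / 2)
    have hoddL : MemLp (if n % 2 = 0 then (0 : Ω → ℝ) else Y k ∘ (T^[2 ^ k])^[n - 1]) 2 μ := by
      split_ifs
      · exact MemLp.zero
      · exact (hYL k).comp_measurePreserving ((hT.iterate _).iterate _)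
    have hlev := memLp_levelSum (m := m) hT hz (k + 1) (n / 2)
    rw [eLpNorm_congr_ae (levelSum_halving hT hm hmT hz k n)]
    refine (eLpNorm_add_le (hlev.add hmartL).aestronglyMeasurable hoddL.aestronglyMeasurable
      one_le_two).trans ?_
    refine (add_le_add_left (eLpNorm_add_le hlev.aestronglyMeasurable
      hmartL.aestronglyMeasurable one_le_two) _).trans ?_
    -- The 2 pays for the innovation, the 1 for the unpaired term.
    rw [add_assoc, show (3 : ENNReal) = 2 + 1 by norm_num, add_mul, mul_add, one_mul]
    gcongr
    · rw [eLpNorm_sum_iterate (hT.iterate _) hm (le_comap_iterate hmT _)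
        (memLp_innov (hYT k)) (stronglyMeasurable_innov (le_comap_iterate hmT _)
          (stronglyMeasurable_level hmT z k))
        (condExp_innov hm ((hYT k).integrable one_le_two))]
      gcongr
      · exact Nat.div_le_self n 2
      · refine (eLpNorm_innov_le (hYT k)).trans ?_
        rw [eLpNorm_comp_measurePreserving (hYL k).aestronglyMeasurable (hT.iterate _)]
    · split_ifs with hn
      · simp
      · rw [eLpNorm_comp_measurePreserving (hYL k).aestronglyMeasurable
          ((hT.iterate _).iterate _)]
        refine le_mul_of_one_le_left zero_le ?_
        rw [ENNReal.one_le_ofReal, Real.one_le_sqrt]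
        exact_mod_cast (by omega : 1 ≤ n)
  have hlevel := le_sqrt_mul_tsum_of_halving
    (u := fun k n => eLpNorm (levelSum m μ T z k n) 2 μ) (γ := fun k => 3 * eLpNorm (Y k) 2 μ)
    (fun k => by
      have : levelSum m μ T z k 0 = 0 := by funext; simp [levelSum]
      simp [this]) hrec n
  rw [shiftSum_eq_levelSum_add (m := m) (μ := μ) z n]
  refine (eLpNorm_add_le (memLp_levelSum hT hz 0 n).aestronglyMeasurable
    (memLp_sum_iterate hT (memLp_innov hzT) n).aestronglyMeasurable one_le_two).trans ?_
  rw [eLpNorm_sum_iterate hT hm hmT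
      (memLp_innov hzT) (stronglyMeasurable_innov hmT (stronglyMeasurable_comp_comap hzm))
      (condExp_innov hm (hzT.integrable one_le_two)), add_comm, dyadicNorm, mul_add, mul_add,
      ← ENNReal.tsum_mul_left]
  simp_rw [mul_div_assoc] at hlevel
  refine add_le_add ?_ hlevel
  gcongr
  refine (eLpNorm_innov_le hzT).trans ?_
  rw [eLpNorm_comp_measurePreserving hz.aestronglyMeasurable hT]
  gcongr
  norm_num

end Dyadic

/-! ### From the Maxwell–Woodroofe series to dyadic scales -/

section Subadditive

/-- A subadditive sequence summable against `n^{-3/2}` is summable along powers of two against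
`2^{-k/2}`. -/
theorem summable_dyadic_of_subadditive {v : ℕ → ℝ} (hv0 : ∀ n, 0 ≤ v n)
    (hadd : ∀ a b, v (a + b) ≤ v a + v b)
    (hs : Summable fun n : ℕ => v (n + 1) / ((n : ℝ) + 1) ^ (3 / 2 : ℝ)) :
    Summable fun k : ℕ => v (2 ^ k) / √(2 ^ k : ℝ) := by
  set c : ℕ → ℝ := fun n => v n / (n : ℝ) ^ (3 / 2 : ℝ) with hc
  have hc0 : ∀ n, 0 ≤ c n := fun n => div_nonneg (hv0 n) (by positivity)
  have hcs : Summable c := by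
    rw [← summable_nat_add_iff 1]
    simpa [hc] using hs
  set b : ℕ → ℝ := fun k => ∑ j ∈ Finset.Ico (2 ^ k) (2 ^ (k + 1)), c j with hb
  have hb0 : ∀ k, 0 ≤ b k := fun k => Finset.sum_nonneg fun j _ => hc0 j
  have hbs : Summable b := by
    refine summable_of_sum_range_le hb0 (c := ∑' n, c n) fun K => ?_
    have : ∑ k ∈ Finset.range K, b k = ∑ j ∈ Finset.Ico 1 (2 ^ K), c j := by
      induction K with
      | zero => simp
      | succ K ih =>
        rw [Finset.sum_range_succ, ih, hb, Finset.sum_Ico_consecutive _ Nat.one_le_two_pow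
          (Nat.pow_le_pow_right two_pos K.le_succ)]
    rw [this]
    exact hcs.sum_le_tsum _ fun j _ => hc0 j
  rw [← summable_nat_add_iff 2]
  refine Summable.of_nonneg_of_le (fun k => div_nonneg (hv0 _) (Real.sqrt_nonneg _)) (fun k => ?_)
    ((hbs.add ((summable_nat_add_iff 1).2 hbs)).mul_left 4)
  set p : ℕ := 2 ^ k with hp
  have hp0 : 0 < p := by positivity
  have hp4 : 2 ^ (k + 2) = 4 * p := by rw [hp]; ring
  -- Average v(4p) ≤ v(j) + v(4p - j) over p ≤ j < 2p. The reflected indices lie in (2p, 3p], so no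
  -- index is used twice.
  have h1 : (p : ℝ) * v (4 * p) ≤ ∑ j ∈ Finset.Ico p (4 * p), v j := by
    calc (p : ℝ) * v (4 * p) = ∑ j ∈ Finset.Ico p (2 * p), v (4 * p) := by
          rw [Finset.sum_const, Nat.card_Ico, nsmul_eq_mul, show 2 * p - p = p by omega]
      _ ≤ ∑ j ∈ Finset.Ico p (2 * p), (v j + v (4 * p - j)) := by
          refine Finset.sum_le_sum fun j hj => ?_
          have := Finset.mem_Ico.1 hj
          have h := hadd j (4 * p - j)
          rwa [show j + (4 * p - j) = 4 * p by omega] at h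
      _ = ∑ j ∈ Finset.Ico p (2 * p), v j + ∑ j ∈ Finset.Ico p (2 * p), v (4 * p - j) :=
          Finset.sum_add_distrib
      _ ≤ ∑ j ∈ Finset.Ico p (2 * p), v j + ∑ j ∈ Finset.Ico (2 * p) (4 * p), v j := by
          gcongr
          rw [← Finset.sum_image (f := v) (g := fun j => 4 * p - j)]
          · refine Finset.sum_le_sum_of_subset_of_nonneg ?_ fun i _ _ => hv0 i
            intro i hi
            obtain ⟨j, hj, rfl⟩ := Finset.mem_image.1 hi
            have := Finset.mem_Ico.1 hj
            exact Finset.mem_Ico.2 ⟨by omega, by omega⟩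
          · intro i hi j hj h
            have h1 := Finset.mem_Ico.1 hi
            have h2 := Finset.mem_Ico.1 hj
            simp only at h
            omega
      _ = _ := Finset.sum_Ico_consecutive _ (by omega) (by omega)
  have h2 : ∑ j ∈ Finset.Ico p (4 * p), v j ≤ ((4 * p : ℕ) : ℝ) ^ (3 / 2 : ℝ) * (b k + b (k + 1)) := by
    have : b k + b (k + 1) = ∑ j ∈ Finset.Ico p (4 * p), c j := by
      rw [hb]
      simp only
      rw [Finset.sum_Ico_consecutive _ (Nat.pow_le_pow_right two_pos (by omega))
        (Nat.pow_le_pow_right two_pos (by omega)), ← hp4]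
    rw [this, Finset.mul_sum]
    refine Finset.sum_le_sum fun j hj => ?_
    have hj := Finset.mem_Ico.1 hj
    have hj0 : (0 : ℝ) < j := by exact_mod_cast (by omega : 0 < j)
    have hle : (j : ℝ) ^ (3 / 2 : ℝ) ≤ ((4 * p : ℕ) : ℝ) ^ (3 / 2 : ℝ) :=
      Real.rpow_le_rpow hj0.le (by exact_mod_cast hj.2.le) (by norm_num)
    calc v j = (j : ℝ) ^ (3 / 2 : ℝ) * c j := by
          rw [hc]; field_simp
      _ ≤ _ := mul_le_mul_of_nonneg_right hle (hc0 j)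
  have hq : (0 : ℝ) < ((4 * p : ℕ) : ℝ) := by exact_mod_cast (by omega : 0 < 4 * p)
  have h3 : ((4 * p : ℕ) : ℝ) ^ (3 / 2 : ℝ) = ((4 * p : ℕ) : ℝ) * √((4 * p : ℕ) : ℝ) := by
    rw [Real.sqrt_eq_rpow, ← Real.rpow_one_add' hq.le (by norm_num)]
    norm_num
  have hcast : (2 : ℝ) ^ (k + 2) = ((4 * p : ℕ) : ℝ) := by rw [← hp4]; push_cast; rfl
  rw [hp4, hcast, div_le_iff₀ (Real.sqrt_pos.2 hq)]
  rw [h3] at h2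
  have h4 := h1.trans h2
  have hpr : (0 : ℝ) < p := by exact_mod_cast hp0
  have h5 : (p : ℝ) * v (4 * p) ≤ p * (4 * (b k + b (k + 1)) * √((4 * p : ℕ) : ℝ)) := by
    refine h4.trans (le_of_eq ?_)
    push_cast
    ring
  exact le_of_mul_le_mul_left h5 hpr

end Subadditive

/-! ### Coboundary approximation for contractions -/

section Contraction

variable {E : Type*} [NormedAddCommGroup E] [NormedSpace ℝ E]

/-- The sum `Q + ⋯ + Q^n`. -/
def powSum (Q : E →L[ℝ] E) (n : ℕ) : E →L[ℝ] E := ∑ j ∈ Finset.range n, Q ^ (j + 1)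

variable {Q : E →L[ℝ] E}

theorem norm_pow_apply_le (hQ : ‖Q‖ ≤ 1) (j : ℕ) (x : E) : ‖(Q ^ j) x‖ ≤ ‖x‖ := by
  induction j with
  | zero => simp
  | succ j ih =>
    rw [pow_succ', mul_apply_eq_comp]
    exact ((Q.le_opNorm _).trans (mul_le_of_le_one_left (norm_nonneg _) hQ)).trans ih

theorem norm_powSum_apply_le (hQ : ‖Q‖ ≤ 1) (n : ℕ) (x : E) : ‖powSum Q n x‖ ≤ n * ‖x‖ := by
  rw [powSum, sum_apply]
  refine (norm_sum_le _ _).trans ((Finset.sum_le_sum fun j _ =>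
    norm_pow_apply_le hQ (j + 1) x).trans (le_of_eq ?_))
  simp

theorem powSum_add (a b : ℕ) : powSum Q (a + b) = powSum Q a + Q ^ a * powSum Q b := by
  rw [powSum, Finset.sum_range_add, powSum, powSum, Finset.mul_sum]
  congr 1
  refine Finset.sum_congr rfl fun j _ => ?_
  rw [← pow_add, add_assoc]

theorem powSum_commute (a b : ℕ) : powSum Q a * powSum Q b = powSum Q b * powSum Q a :=
  Commute.sum_left _ _ _ fun _ _ => Commute.sum_right _ _ _ fun _ _ =>
    (Commute.refl Q).pow_pow _ _

/-- Average over k < n the telescoping identity x - Q^{k+1}x = (1 - Q)(1 + Q + ⋯ + Q^k)x. -/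
theorem exists_eq_coboundary_add_average (x : E) {n : ℕ} (hn : n ≠ 0) :
    ∃ y, x = (y - Q y) + (n : ℝ)⁻¹ • powSum Q n x := by
  have hn' : (n : ℝ) ≠ 0 := by exact_mod_cast hn
  refine ⟨(n : ℝ)⁻¹ • ∑ k ∈ Finset.range n, (∑ j ∈ Finset.range (k + 1), Q ^ j) x, ?_⟩
  have h : ∀ k : ℕ, (∑ j ∈ Finset.range (k + 1), Q ^ j) x -
      Q ((∑ j ∈ Finset.range (k + 1), Q ^ j) x) = x - (Q ^ (k + 1)) x := by
    intro k
    have := congrArg (fun A : E →L[ℝ] E => A x) (mul_neg_geom_sum Q (k + 1))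
    simpa [sub_mul] using this
  rw [map_smul, map_sum, ← smul_sub, ← Finset.sum_sub_distrib, Finset.sum_congr rfl fun k _ => h k,
    ← smul_add, powSum, sum_apply, Finset.sum_sub_distrib, sub_add_cancel]
  simp [← Nat.cast_smul_eq_nsmul ℝ, smul_smul, hn']

/-- Under the Maxwell–Woodroofe condition every vector is a coboundary up to a small error in the
dyadic Maxwell–Woodroofe norm. -/
theorem exists_coboundary_approx (hQ : ‖Q‖ ≤ 1) {x : E}
    (hs : Summable fun n : ℕ => ‖powSum Q (n + 1) x‖ / ((n : ℝ) + 1) ^ (3 / 2 : ℝ))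
    {ε : ℝ} (hε : 0 < ε) :
    ∃ y z : E, x = (y - Q y) + z ∧ (Summable fun k : ℕ => ‖powSum Q (2 ^ k) z‖ / √(2 ^ k : ℝ)) ∧
      ‖z‖ + ∑' k : ℕ, ‖powSum Q (2 ^ k) z‖ / √(2 ^ k : ℝ) ≤ ε := by
  have hdy : Summable fun k : ℕ => ‖powSum Q (2 ^ k) x‖ / √(2 ^ k : ℝ) := by
    refine summable_dyadic_of_subadditive (v := fun n => ‖powSum Q n x‖)
      (fun n => norm_nonneg _) (fun a b => ?_) hs
    rw [powSum_add, add_apply, mul_apply_eq_comp]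
    exact (norm_add_le _ _).trans (add_le_add_right (norm_pow_apply_le hQ _ _) _)
  -- The averaging operator is a contraction commuting with `powSum`, so the dyadic terms of z_r are
  -- dominated by those of x. Each tends to 0 with ‖z_r‖, and dominated convergence applies to the
  -- series.
  set z : ℕ → E := fun r => ((2 ^ r : ℕ) : ℝ)⁻¹ • powSum Q (2 ^ r) x with hz
  have hznorm : ∀ r, ‖z r‖ = ‖powSum Q (2 ^ r) x‖ / (2 ^ r : ℝ) := by
    intro r
    rw [hz, norm_smul, norm_inv, Real.norm_natCast, div_eq_inv_mul]
    push_cast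
    rfl
  have hz0 : Tendsto (fun r => ‖z r‖) atTop (𝓝 0) := by
    refine squeeze_zero (fun r => norm_nonneg _) (fun r => ?_) hdy.tendsto_atTop_zero
    rw [hznorm]
    refine div_le_div_of_nonneg_left (norm_nonneg _) (by positivity) ?_
    exact Real.sqrt_le_iff.2 ⟨by positivity, le_self_pow₀ (one_le_pow₀ one_le_two) two_ne_zero⟩
  have hbound : ∀ r k : ℕ, ‖powSum Q (2 ^ k) (z r)‖ / √(2 ^ k : ℝ) ≤
      ‖powSum Q (2 ^ k) x‖ / √(2 ^ k : ℝ) := by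
    intro r k
    gcongr
    rw [hz, map_smul, ← mul_apply_eq_comp, powSum_commute,
      mul_apply_eq_comp, norm_smul, norm_inv, Real.norm_natCast,
      inv_mul_le_iff₀ (by positivity)]
    exact norm_powSum_apply_le hQ _ _
  have hsum : ∀ r, Summable fun k : ℕ => ‖powSum Q (2 ^ k) (z r)‖ / √(2 ^ k : ℝ) := fun r =>
    Summable.of_nonneg_of_le (fun k => by positivity) (hbound r) hdy
  have htend : Tendsto (fun r => ∑' k : ℕ, ‖powSum Q (2 ^ k) (z r)‖ / √(2 ^ k : ℝ)) atTop
      (𝓝 (∑' _ : ℕ, (0 : ℝ))) := by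
    refine tendsto_tsum_of_dominated_convergence hdy (fun k => ?_)
      (Eventually.of_forall fun r k => ?_)
    · have h1 : Tendsto (fun r => ((2 ^ k : ℕ) : ℝ) * ‖z r‖ / √(2 ^ k : ℝ)) atTop
          (𝓝 (((2 ^ k : ℕ) : ℝ) * 0 / √(2 ^ k : ℝ))) := (hz0.const_mul _).div_const _
      rw [mul_zero, zero_div] at h1
      exact squeeze_zero (fun r => by positivity)
        (fun r => div_le_div_of_nonneg_right (norm_powSum_apply_le hQ _ _) (Real.sqrt_nonneg _)) h1
    · rw [Real.norm_of_nonneg (by positivity)]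
      exact hbound r k
  rw [tsum_zero] at htend
  have hall := hz0.add htend
  rw [add_zero] at hall
  obtain ⟨r, hr⟩ := (hall.eventually (ge_mem_nhds hε)).exists
  obtain ⟨y, hy⟩ := exists_eq_coboundary_add_average (Q := Q) x (n := 2 ^ r) (by positivity)
  exact ⟨y, z r, hy, hsum r, hr⟩

end Contraction

/-! ### The contraction h ↦ E(h ∘ T | m) on L² -/

section Bridge

variable {Ω : Type*} {m : MeasurableSpace Ω} [mΩ : MeasurableSpace Ω] {μ : Measure Ω}
  [IsProbabilityMeasure μ] {T : Ω → Ω}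

/-- The operator `h ↦ E(h ∘ T | m)` on the square integrable `m`-measurable functions. -/
noncomputable def condKoopman (hT : MeasurePreserving T μ μ) (hm : m ≤ mΩ) :
    lpMeas ℝ ℝ m 2 μ →L[ℝ] lpMeas ℝ ℝ m 2 μ :=
  (condExpL2 ℝ ℝ hm).comp
    ((Lp.compMeasurePreservingₗᵢ ℝ T hT).toContinuousLinearMap.comp (lpMeas ℝ ℝ m 2 μ).subtypeL)

theorem norm_condKoopman_le (hT : MeasurePreserving T μ μ) (hm : m ≤ mΩ) :
    ‖condKoopman hT hm‖ ≤ 1 := by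
  refine ContinuousLinearMap.opNorm_le_bound _ zero_le_one fun x => ?_
  rw [one_mul]
  refine (norm_condExpL2_le hm _).trans (le_of_eq ?_)
  exact (Lp.compMeasurePreservingₗᵢ ℝ T hT).norm_map _

theorem condKoopman_ae_eq (hT : MeasurePreserving T μ μ) (hm : m ≤ mΩ) (x : lpMeas ℝ ℝ m 2 μ) :
    (condKoopman hT hm x : Ω → ℝ) =ᵐ[μ] μ[(x : Ω → ℝ) ∘ T | m] := by
  have h := (Lp.memLp (x : Lp ℝ 2 μ)).comp_measurePreserving hT
  have h1 : condKoopman hT hm x = condExpL2 ℝ ℝ hm (h.toLp _) := by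
    rw [condKoopman, ContinuousLinearMap.comp_apply, ContinuousLinearMap.comp_apply]
    congr 1
    refine Lp.ext ?_
    exact (Lp.coeFn_compMeasurePreserving _ hT).trans h.coeFn_toLp.symm
  rw [h1]
  exact h.condExpL2_ae_eq_condExp hm

theorem condKoopman_pow_ae_eq (hT : MeasurePreserving T μ μ) (hm : m ≤ mΩ)
    (hmT : m ≤ m.comap T) (x : lpMeas ℝ ℝ m 2 μ) (j : ℕ) :
    (((condKoopman hT hm) ^ j) x : Ω → ℝ) =ᵐ[μ] μ[(x : Ω → ℝ) ∘ T^[j] | m] := by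
  have hx := Lp.memLp (x : Lp ℝ 2 μ)
  induction j with
  | zero =>
    simpa using (condExp_of_aestronglyMeasurable' hm (lpMeas.aestronglyMeasurable x)
      (hx.integrable one_le_two)).symm
  | succ j ih =>
    rw [pow_succ', mul_apply_eq_comp]
    refine (condKoopman_ae_eq hT hm _).trans ((condExp_congr_ae
      (hT.quasiMeasurePreserving.ae_eq_comp ih)).trans ?_)
    exact condExp_condExp_comp hT hm hmT
      ((hx.comp_measurePreserving (hT.iterate j)).integrable one_le_two)

theorem powSum_condKoopman_ae_eq (hT : MeasurePreserving T μ μ) (hm : m ≤ mΩ)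
    (hmT : m ≤ m.comap T) (x : lpMeas ℝ ℝ m 2 μ) (n : ℕ) :
    (powSum (condKoopman hT hm) n x : Ω → ℝ) =ᵐ[μ] μ[shiftSum T (x : Ω → ℝ) n | m] := by
  have hx := Lp.memLp (x : Lp ℝ 2 μ)
  have h1 : shiftSum T (x : Ω → ℝ) n = ∑ j ∈ Finset.range n, (x : Ω → ℝ) ∘ T^[j + 1] := by
    funext ω; simp [shiftSum]
  have h2 : ((powSum (condKoopman hT hm) n x : lpMeas ℝ ℝ m 2 μ) : Lp ℝ 2 μ) =
      ∑ j ∈ Finset.range n, ((((condKoopman hT hm) ^ (j + 1)) x : lpMeas ℝ ℝ m 2 μ) : Lp ℝ 2 μ) := by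
    rw [powSum, sum_apply, AddSubmonoidClass.coe_finsetSum]
  rw [h1, h2]
  filter_upwards [Lp.coeFn_finsetSum (Finset.range n)
      (fun j => ((((condKoopman hT hm) ^ (j + 1)) x : lpMeas ℝ ℝ m 2 μ) : Lp ℝ 2 μ)),
    ae_all_iff.2 fun j => condKoopman_pow_ae_eq hT hm hmT x (j + 1),
    condExp_finsetSum (s := Finset.range n) (f := fun j => (x : Ω → ℝ) ∘ T^[j + 1])
      (fun j _ => (hx.comp_measurePreserving (hT.iterate (j + 1))).integrable one_le_two) m]
    with ω h3 h4 h5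
  rw [h3, h5]
  simp only [Finset.sum_apply, h4]

theorem shiftSum_congr (hT : MeasurePreserving T μ μ) {f g : Ω → ℝ} (h : f =ᵐ[μ] g) (n : ℕ) :
    shiftSum T f n =ᵐ[μ] shiftSum T g n := by
  filter_upwards [ae_all_iff.2 fun j : ℕ =>
    (hT.iterate (j + 1)).quasiMeasurePreserving.ae_eq_comp h] with ω h
  exact Finset.sum_congr rfl fun j _ => h j

theorem exists_stronglyMeasurable_rep (x : lpMeas ℝ ℝ m 2 μ) :
    ∃ f : Ω → ℝ, StronglyMeasurable[m] f ∧ MemLp f 2 μ ∧ (x : Ω → ℝ) =ᵐ[μ] f := by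
  obtain ⟨f, hf, hxf⟩ := lpMeas.aestronglyMeasurable x
  exact ⟨f, hf, (memLp_congr_ae hxf).1 (Lp.memLp (x : Lp ℝ 2 μ)), hxf⟩

/-- The abstract approximation for `condKoopman`, read back on functions. Genuinely `m`-measurable
representatives are chosen, since the martingale lemmas require them. -/
theorem exists_coboundary_approx_fun (hT : MeasurePreserving T μ μ) (hm : m ≤ mΩ)
    (hmT : m ≤ m.comap T) {X : Ω → ℝ} (hX : MemLp X 2 μ) (hXm : StronglyMeasurable[m] X)
    (hMW : ∑' n : ℕ, eLpNorm (μ[shiftSum T X (n + 1) | m]) 2 μ /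
      ENNReal.ofReal (((n : ℝ) + 1) ^ (3 / 2 : ℝ)) < ⊤) {ε : ℝ} (hε : 0 < ε) :
    ∃ y z : Ω → ℝ, StronglyMeasurable[m] y ∧ MemLp y 2 μ ∧ StronglyMeasurable[m] z ∧
      MemLp z 2 μ ∧ X =ᵐ[μ] (y - μ[y ∘ T | m]) + z ∧
      dyadicNorm m μ T z ≤ ENNReal.ofReal ε := by
  set x : lpMeas ℝ ℝ m 2 μ := ⟨hX.toLp X, mem_lpMeas_iff_aestronglyMeasurable.2
    (hXm.aestronglyMeasurable.congr hX.coeFn_toLp.symm)⟩ with hx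
  have hxX : (x : Ω → ℝ) =ᵐ[μ] X := hX.coeFn_toLp
  have hnorm : ∀ w : lpMeas ℝ ℝ m 2 μ, ‖w‖ = (eLpNorm (w : Ω → ℝ) 2 μ).toReal := fun w => rfl
  have hfin : ∀ w : lpMeas ℝ ℝ m 2 μ, eLpNorm (w : Ω → ℝ) 2 μ ≠ ⊤ := fun w =>
    (Lp.memLp (w : Lp ℝ 2 μ)).eLpNorm_ne_top
  have hV : ∀ (w : lpMeas ℝ ℝ m 2 μ) (f : Ω → ℝ), (w : Ω → ℝ) =ᵐ[μ] f → ∀ n,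
      eLpNorm (powSum (condKoopman hT hm) n w : Ω → ℝ) 2 μ =
        eLpNorm (μ[shiftSum T f n | m]) 2 μ := fun w f hwf n =>
    eLpNorm_congr_ae ((powSum_condKoopman_ae_eq hT hm hmT w n).trans
      (condExp_congr_ae (shiftSum_congr hT hwf n)))
  have hs : Summable fun n : ℕ => ‖powSum (condKoopman hT hm) (n + 1) x‖ /
      ((n : ℝ) + 1) ^ (3 / 2 : ℝ) := by
    refine (ENNReal.summable_toReal hMW.ne).congr fun n => ?_
    rw [hnorm, hV x X hxX, ENNReal.toReal_div, ENNReal.toReal_ofReal (by positivity)]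
  obtain ⟨y, z, hxyz, hzs, hzε⟩ := exists_coboundary_approx (norm_condKoopman_le hT hm) hs hε
  obtain ⟨y', hym, hyL, hyy⟩ := exists_stronglyMeasurable_rep y
  obtain ⟨z', hzm, hzL, hzz⟩ := exists_stronglyMeasurable_rep z
  refine ⟨y', z', hym, hyL, hzm, hzL, ?_, ?_⟩
  · have hcoe : (x : Lp ℝ 2 μ) = ((y : Lp ℝ 2 μ) - (condKoopman hT hm y : lpMeas ℝ ℝ m 2 μ)) + z := by
      conv_lhs => rw [hxyz]
      rfl
    filter_upwards [hxX, Lp.coeFn_add ((y : Lp ℝ 2 μ) -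
        ((condKoopman hT hm y : lpMeas ℝ ℝ m 2 μ) : Lp ℝ 2 μ)) (z : Lp ℝ 2 μ),
      Lp.coeFn_sub (y : Lp ℝ 2 μ) ((condKoopman hT hm y : lpMeas ℝ ℝ m 2 μ) : Lp ℝ 2 μ),
      hyy, hzz,
      condKoopman_ae_eq hT hm y,
      condExp_congr_ae (m := m) (hT.quasiMeasurePreserving.ae_eq_comp hyy)]
      with ω h1 h2 h3 h4 h5 h6 h7
    rw [← h1, hcoe, h2, Pi.add_apply, h3, Pi.sub_apply, h4, h5, h6, h7]
    simp
  · have hterm : ∀ k : ℕ, eLpNorm (dyadicCond m μ T z' k) 2 μ / ENNReal.ofReal √(2 ^ k) =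
        ENNReal.ofReal (‖powSum (condKoopman hT hm) (2 ^ k) z‖ / √(2 ^ k : ℝ)) := by
      intro k
      rw [ENNReal.ofReal_div_of_pos (by positivity), hnorm, ENNReal.ofReal_toReal (hfin _),
        hV z z' hzz, dyadicCond]
    rw [dyadicNorm, ← eLpNorm_congr_ae hzz]
    simp_rw [hterm]
    rw [← ENNReal.ofReal_tsum_of_nonneg (fun k => by positivity) hzs,
      ← ENNReal.ofReal_toReal (hfin z), ← hnorm, ← ENNReal.ofReal_add (norm_nonneg _)
        (tsum_nonneg fun k => by positivity)]
    exact ENNReal.ofReal_le_ofReal hzε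

end Bridge

/-! ### The approximating martingale, in L² and almost surely -/

section Approximation

variable {Ω : Type*} {m : MeasurableSpace Ω} [mΩ : MeasurableSpace Ω] {μ : Measure Ω}
  [IsProbabilityMeasure μ] {T : Ω → Ω}

/-- The sum `d + d ∘ T + ⋯ + d ∘ T^{n-1}`. -/
def orbitSum {Ω : Type*} (T : Ω → Ω) (d : Ω → ℝ) (n : ℕ) : Ω → ℝ :=
  fun ω => ∑ j ∈ Finset.range n, d (T^[j] ω)

theorem memLp_orbitSum (hT : MeasurePreserving T μ μ) {d : Ω → ℝ} (hd : MemLp d 2 μ) (n : ℕ) :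
    MemLp (orbitSum T d n) 2 μ := memLp_sum_iterate hT hd n

theorem condNorm_sub_le {f g : Ω → ℝ} (hf : MemLp f 2 μ) (hg : MemLp g 2 μ) :
    ∀ᵐ ω ∂μ, condNorm m μ (f - g) ω ≤ condNorm m μ f ω + condNorm m μ g ω := by
  have h : ∀ ω, condNorm m μ (-g) ω = condNorm m μ g ω := fun ω => by simp [condNorm]
  filter_upwards [condNorm_add_le (m := m) hf hg.neg] with ω h1
  rw [h] at h1
  rwa [sub_eq_add_neg]

/-- The approximation error of a perturbed coboundary `(y - E(y ∘ T | m)) + z`. -/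
theorem shiftSum_sub_orbitSum_ae_eq (hT : MeasurePreserving T μ μ) {X y z : Ω → ℝ}
    (hX : X =ᵐ[μ] (y - μ[y ∘ T | m]) + z) (d : Ω → ℝ) (n : ℕ) :
    shiftSum T X n - orbitSum T d n =ᵐ[μ]
      ((μ[y ∘ T | m] - μ[y ∘ T | m] ∘ T^[n]) + shiftSum T z n) +
        orbitSum T (innov m μ (y ∘ T) - d) n := by
  filter_upwards [shiftSum_congr hT hX n] with ω h
  rw [Pi.sub_apply, h]
  -- With y ∘ T = innovation + Qy, the part y - Qy of X contributes the innovation along the orbit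
  -- plus the telescoping sum of (Qy) ∘ T^j - (Qy) ∘ T^{j+1}.
  have htel := Finset.sum_range_sub' (fun j => (μ[y ∘ T | m]) (T^[j] ω)) n
  simp only [shiftSum, orbitSum, innov, Pi.add_apply, Pi.sub_apply, Finset.sum_add_distrib,
    Finset.sum_sub_distrib, Function.comp_apply, Function.iterate_zero, id] at htel ⊢
  rw [← htel]
  simp_rw [← Function.iterate_succ_apply' T]
  ring

theorem eLpNorm_error_le (hT : MeasurePreserving T μ μ) (hm : m ≤ mΩ) (hmT : m ≤ m.comap T)
    {X y z d : Ω → ℝ} (hX : X =ᵐ[μ] (y - μ[y ∘ T | m]) + z) (hym : StronglyMeasurable[m] y)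
    (hy : MemLp y 2 μ) (hzm : StronglyMeasurable[m] z) (hz : MemLp z 2 μ)
    (hdm : StronglyMeasurable[m.comap T] d) (hd : MemLp d 2 μ) (hd0 : μ[d | m] =ᵐ[μ] 0) (n : ℕ) :
    eLpNorm (shiftSum T X n - orbitSum T d n) 2 μ ≤ 2 * eLpNorm y 2 μ +
      ENNReal.ofReal √(n : ℝ) * (3 * dyadicNorm m μ T z +
        eLpNorm (innov m μ (y ∘ T) - d) 2 μ) := by
  have hyT := hy.comp_measurePreserving hT
  have hQ : MemLp (μ[y ∘ T | m]) 2 μ := hyT.condExp one_le_two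
  have hQn := hQ.comp_measurePreserving (hT.iterate n)
  have hS := memLp_shiftSum hT hz n
  have hdd := (memLp_innov (m := m) hyT).sub hd
  have hO := memLp_orbitSum hT hdd n
  have hQy : eLpNorm (μ[y ∘ T | m]) 2 μ ≤ eLpNorm y 2 μ := by
    refine (eLpNorm_condExp_le_eLpNorm _ one_le_two).trans (le_of_eq ?_)
    exact eLpNorm_comp_measurePreserving hy.aestronglyMeasurable hT
  have hdd0 : μ[innov m μ (y ∘ T) - d | m] =ᵐ[μ] 0 := by
    filter_upwards [condExp_sub ((memLp_innov (m := m) hyT).integrable one_le_two)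
      (hd.integrable one_le_two) m, hd0, condExp_innov hm (hyT.integrable one_le_two)]
      with ω h1 h2 h3
    rw [h1, Pi.sub_apply, h2, h3]
    simp
  rw [eLpNorm_congr_ae (shiftSum_sub_orbitSum_ae_eq hT hX d n), mul_add, ← add_assoc, two_mul]
  refine (eLpNorm_add_le ((hQ.sub hQn).add hS).aestronglyMeasurable hO.aestronglyMeasurable
    one_le_two).trans (add_le_add ?_ ?_)
  · refine (eLpNorm_add_le (hQ.sub hQn).aestronglyMeasurable hS.aestronglyMeasurable
      one_le_two).trans (add_le_add ?_ (eLpNorm_shiftSum_le hT hm hmT hz hzm n))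
    refine (eLpNorm_sub_le hQ.aestronglyMeasurable hQn.aestronglyMeasurable one_le_two).trans
      (add_le_add hQy ?_)
    rwa [eLpNorm_comp_measurePreserving hQ.aestronglyMeasurable (hT.iterate n)]
  · exact (eLpNorm_sum_iterate hT hm hmT hdd ((stronglyMeasurable_innov hmT
      (stronglyMeasurable_comp_comap hym)).sub hdm) hdd0 n).le

/-- Divide by √n and let n tend to infinity. This removes the boundary terms, whose size in y is
uncontrolled. -/
theorem le_of_forall_sqrt_mul_le {a b c : ENNReal} (hc : c ≠ ⊤)
    (h : ∀ n : ℕ, ENNReal.ofReal √(n : ℝ) * a ≤ c + ENNReal.ofReal √(n : ℝ) * b) : a ≤ b := by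
  have ht : Tendsto (fun n : ℕ => c / ENNReal.ofReal √(n : ℝ) + b) atTop (𝓝 (0 + b)) :=
    (tendsto_div_ofReal_sqrt hc).add tendsto_const_nhds
  rw [zero_add] at ht
  refine ge_of_tendsto ht ?_
  filter_upwards [eventually_ge_atTop 1] with n hn
  have h0 := ofReal_sqrt_pos (n := n) (by omega)
  have h1 : ENNReal.ofReal √(n : ℝ) ≠ ⊤ := ENNReal.ofReal_ne_top
  have := ENNReal.div_le_div_right (h n) (ENNReal.ofReal √(n : ℝ))
  rw [mul_comm, ENNReal.mul_div_cancel_right h0 h1, ENNReal.add_div,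
    mul_comm, ENNReal.mul_div_cancel_right h0 h1] at this
  exact this

/-- `d` is the limit of the martingale differences of coboundaries approximating `X`. -/
def IsApproxDiff {Ω : Type*} (m : MeasurableSpace Ω) [MeasurableSpace Ω]
    (μ : Measure Ω) (T : Ω → Ω) (X d : Ω → ℝ) : Prop :=
  ∀ ε : ℝ, 0 < ε → ∃ y z : Ω → ℝ, StronglyMeasurable[m] y ∧ MemLp y 2 μ ∧
    StronglyMeasurable[m] z ∧ MemLp z 2 μ ∧ X =ᵐ[μ] (y - μ[y ∘ T | m]) + z ∧
    dyadicNorm m μ T z ≤ ENNReal.ofReal ε ∧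
    eLpNorm (innov m μ (y ∘ T) - d) 2 μ ≤ ENNReal.ofReal ε

/-- Both martingales approximate the same S_n, while the norm of their difference is exactly √n
times that of the difference of the increments. Good approximations therefore have close increments.
-/
theorem eLpNorm_innov_sub_innov_le (hT : MeasurePreserving T μ μ) (hm : m ≤ mΩ)
    (hmT : m ≤ m.comap T) {X y₁ z₁ y₂ z₂ : Ω → ℝ}
    (hX₁ : X =ᵐ[μ] (y₁ - μ[y₁ ∘ T | m]) + z₁) (hym₁ : StronglyMeasurable[m] y₁)
    (hy₁ : MemLp y₁ 2 μ) (hzm₁ : StronglyMeasurable[m] z₁) (hz₁ : MemLp z₁ 2 μ)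
    (hX₂ : X =ᵐ[μ] (y₂ - μ[y₂ ∘ T | m]) + z₂) (hym₂ : StronglyMeasurable[m] y₂)
    (hy₂ : MemLp y₂ 2 μ) (hzm₂ : StronglyMeasurable[m] z₂) (hz₂ : MemLp z₂ 2 μ) :
    eLpNorm (innov m μ (y₁ ∘ T) - innov m μ (y₂ ∘ T)) 2 μ ≤
      3 * dyadicNorm m μ T z₁ + 3 * dyadicNorm m μ T z₂ := by
  have key : ∀ {y z : Ω → ℝ}, X =ᵐ[μ] (y - μ[y ∘ T | m]) + z → StronglyMeasurable[m] y →
      MemLp y 2 μ → StronglyMeasurable[m] z → MemLp z 2 μ → ∀ n : ℕ,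
      eLpNorm (shiftSum T X n - orbitSum T (innov m μ (y ∘ T)) n) 2 μ ≤ 2 * eLpNorm y 2 μ +
        ENNReal.ofReal √(n : ℝ) * (3 * dyadicNorm m μ T z) := by
    intro y z hX hym hy hzm hz n
    have hyT := hy.comp_measurePreserving hT
    have := eLpNorm_error_le hT hm hmT hX hym hy hzm hz (stronglyMeasurable_innov hmT
      (stronglyMeasurable_comp_comap hym)) (memLp_innov hyT)
      (condExp_innov hm (hyT.integrable one_le_two)) n
    simpa using this
  have hXL : MemLp X 2 μ := (memLp_congr_ae hX₁).2
    ((hy₁.sub ((hy₁.comp_measurePreserving hT).condExp one_le_two)).add hz₁)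
  have hy₁T := hy₁.comp_measurePreserving hT
  have hy₂T := hy₂.comp_measurePreserving hT
  have hd := (memLp_innov (m := m) hy₁T).sub (memLp_innov (m := m) hy₂T)
  refine le_of_forall_sqrt_mul_le (c := 2 * eLpNorm y₁ 2 μ + 2 * eLpNorm y₂ 2 μ)
    (ENNReal.add_ne_top.2 ⟨ENNReal.mul_ne_top (by norm_num) hy₁.eLpNorm_ne_top,
      ENNReal.mul_ne_top (by norm_num) hy₂.eLpNorm_ne_top⟩) fun n => ?_
  have hd0 : μ[innov m μ (y₁ ∘ T) - innov m μ (y₂ ∘ T) | m] =ᵐ[μ] 0 := by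
    filter_upwards [condExp_sub ((memLp_innov (m := m) hy₁T).integrable one_le_two)
      ((memLp_innov (m := m) hy₂T).integrable one_le_two) m,
      condExp_innov hm (hy₁T.integrable one_le_two),
      condExp_innov hm (hy₂T.integrable one_le_two)]
      with ω h1 h2 h3
    rw [h1, Pi.sub_apply, h2, h3]
    simp
  have heq := eLpNorm_sum_iterate hT hm hmT hd ((stronglyMeasurable_innov hmT
    (stronglyMeasurable_comp_comap hym₁)).sub (stronglyMeasurable_innov hmT
    (stronglyMeasurable_comp_comap hym₂))) hd0 n
  have hdiff : (fun ω => ∑ j ∈ Finset.range n,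
      (innov m μ (y₁ ∘ T) - innov m μ (y₂ ∘ T)) (T^[j] ω)) =
      (shiftSum T X n - orbitSum T (innov m μ (y₂ ∘ T)) n) -
        (shiftSum T X n - orbitSum T (innov m μ (y₁ ∘ T)) n) := by
    funext ω
    simp [orbitSum, Finset.sum_sub_distrib]
  rw [← heq, hdiff]
  have hS := memLp_shiftSum hT hXL n
  refine (eLpNorm_sub_le (hS.sub (memLp_orbitSum hT (memLp_innov hy₂T) n)).aestronglyMeasurable
    (hS.sub (memLp_orbitSum hT (memLp_innov hy₁T) n)).aestronglyMeasurable one_le_two).trans ?_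
  refine (add_le_add (key hX₂ hym₂ hy₂ hzm₂ hz₂ n) (key hX₁ hym₁ hy₁ hzm₁ hz₁ n)).trans
    (le_of_eq ?_)
  ring

/-- Under the Maxwell–Woodroofe condition an approximating martingale difference exists. -/
theorem exists_isApproxDiff (hT : MeasurePreserving T μ μ) (hm : m ≤ mΩ)
    (hmT : m ≤ m.comap T) {X : Ω → ℝ} (hX : MemLp X 2 μ) (hXm : StronglyMeasurable[m] X)
    (hMW : ∑' n : ℕ, eLpNorm (μ[shiftSum T X (n + 1) | m]) 2 μ /
      ENNReal.ofReal (((n : ℝ) + 1) ^ (3 / 2 : ℝ)) < ⊤) :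
    ∃ d : Ω → ℝ, MemLp d 2 μ ∧ StronglyMeasurable[m.comap T] d ∧ μ[d | m] =ᵐ[μ] 0 ∧
      IsApproxDiff m μ T X d := by
  choose y z hym hy hzm hz hXyz hN using fun k : ℕ =>
    exists_coboundary_approx_fun hT hm hmT hX hXm hMW (ε := (1 / 2) ^ k) (by positivity)
  have hle := comap_le_of_measurePreserving hT hm
  have hyT : ∀ k, MemLp (y k ∘ T) 2 μ := fun k => (hy k).comp_measurePreserving hT
  set δ : ℕ → Ω → ℝ := fun k => innov m μ (y k ∘ T) with hδ
  have hδL : ∀ k, MemLp (δ k) 2 μ := fun k => memLp_innov (hyT k)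
  have hδm : ∀ k, StronglyMeasurable[m.comap T] (δ k) := fun k =>
    stronglyMeasurable_innov hmT (stronglyMeasurable_comp_comap (hym k))
  have hδ0 : ∀ k, μ[δ k | m] =ᵐ[μ] 0 := fun k => condExp_innov hm ((hyT k).integrable one_le_two)
  obtain ⟨D, hD, hlim⟩ := Lp.cauchy_complete_eLpNorm one_le_two hδL
    -- The distances are at most 3 + 3 = 6 times 2^{-N}; 7 makes the inequality strict.
    (B := fun N => ENNReal.ofReal (7 * (1 / 2) ^ N)) (by
      rw [← ENNReal.ofReal_tsum_of_nonneg (fun N => by positivity)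
        (summable_geometric_two.mul_left 7)]
      exact ENNReal.ofReal_ne_top) (fun N k l hk hl => by
      refine (eLpNorm_innov_sub_innov_le hT hm hmT (hXyz k) (hym k) (hy k) (hzm k) (hz k)
        (hXyz l) (hym l) (hy l) (hzm l) (hz l)).trans_lt ?_
      have h1 : ∀ i, N ≤ i → dyadicNorm m μ T (z i) ≤ ENNReal.ofReal ((1 / 2) ^ N) := fun i hi =>
        (hN i).trans (ENNReal.ofReal_le_ofReal
          (pow_le_pow_of_le_one (by norm_num) (by norm_num) hi))
      calc _ ≤ 3 * ENNReal.ofReal ((1 / 2) ^ N) + 3 * ENNReal.ofReal ((1 / 2) ^ N) := by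
            gcongr
            · exact h1 k hk
            · exact h1 l hl
        _ = ENNReal.ofReal (6 * (1 / 2) ^ N) := by
            rw [ENNReal.ofReal_mul (by norm_num), ENNReal.ofReal_ofNat]; ring
        _ < _ := by
            rw [ENNReal.ofReal_lt_ofReal_iff (by positivity)]
            have : (0 : ℝ) < (1 / 2) ^ N := by positivity
            linarith)
  -- The limit D is known only as an L² limit. Projecting it on T⁻¹m and then centring restores
  -- exact measurability and E(d | m) = 0, at the cost of a factor 2 in the distances.
  set D₁ : Ω → ℝ := μ[D | m.comap T] with hD₁
  have hD₁L : MemLp D₁ 2 μ := hD.condExp one_le_two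
  refine ⟨innov m μ D₁, memLp_innov hD₁L, stronglyMeasurable_innov hmT stronglyMeasurable_condExp,
    condExp_innov hm (hD₁L.integrable one_le_two), fun ε hε => ?_⟩
  have hdist : ∀ k, eLpNorm (δ k - innov m μ D₁) 2 μ ≤ 2 * eLpNorm (δ k - D) 2 μ := by
    intro k
    have h1 : δ k - innov m μ D₁ =ᵐ[μ] innov m μ (μ[δ k - D | m.comap T]) := by
      have h2 : μ[δ k - D | m.comap T] =ᵐ[μ] δ k - D₁ := by
        filter_upwards [condExp_sub (μ := μ) ((hδL k).integrable one_le_two)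
          (hD.integrable one_le_two) (m.comap T)] with ω h3
        rw [h3, condExp_of_stronglyMeasurable hle (hδm k) ((hδL k).integrable one_le_two)]
      filter_upwards [h2, condExp_congr_ae (m := m) h2, condExp_sub (μ := μ)
        ((hδL k).integrable one_le_two) (hD₁L.integrable one_le_two) m, hδ0 k] with ω h3 h4 h5 h6
      simp only [innov, Pi.sub_apply] at h3 h4 h5 ⊢
      rw [h3, h4, h5, h6, Pi.zero_apply]
      ring
    rw [eLpNorm_congr_ae h1]
    have hsub := (hδL k).sub hD
    exact (eLpNorm_innov_le (hsub.condExp one_le_two)).trans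
      (by gcongr; exact eLpNorm_condExp_le_eLpNorm _ one_le_two)
  have h2lim : Tendsto (fun k => 2 * eLpNorm (δ k - D) 2 μ) atTop (𝓝 0) := by
    simpa using ENNReal.Tendsto.const_mul (a := 2) hlim (Or.inr (by norm_num))
  have hpow : Tendsto (fun k : ℕ => ((1 : ℝ) / 2) ^ k) atTop (𝓝 0) :=
    tendsto_pow_atTop_nhds_zero_of_lt_one (by norm_num) (by norm_num)
  obtain ⟨k, hk1, hk2⟩ := ((ENNReal.tendsto_nhds_zero.1 h2lim (ENNReal.ofReal ε)
    (by simpa using hε)).and (hpow.eventually (ge_mem_nhds hε))).exists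
  exact ⟨y k, z k, hym k, hy k, hzm k, hz k, hXyz k,
    (hN k).trans (ENNReal.ofReal_le_ofReal hk2), (hdist k).trans hk1⟩

/-- Martingale approximation in `L²`. -/
theorem tendsto_eLpNorm_error (hT : MeasurePreserving T μ μ) (hm : m ≤ mΩ)
    (hmT : m ≤ m.comap T) {X d : Ω → ℝ} (hd : MemLp d 2 μ)
    (hdm : StronglyMeasurable[m.comap T] d) (hd0 : μ[d | m] =ᵐ[μ] 0)
    (h : IsApproxDiff m μ T X d) :
    Tendsto (fun n : ℕ => eLpNorm (shiftSum T X n - orbitSum T d n) 2 μ /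
      ENNReal.ofReal √(n : ℝ)) atTop (𝓝 0) := by
  rw [ENNReal.tendsto_nhds_zero]
  intro η hη
  obtain ⟨ε, hε, hεη⟩ : ∃ ε : ℝ, 0 < ε ∧ ENNReal.ofReal (5 * ε) ≤ η := by
    by_cases htop : η = ⊤
    · exact ⟨1, one_pos, by simp [htop]⟩
    · refine ⟨η.toReal / 5, div_pos (ENNReal.toReal_pos hη.ne' htop) (by norm_num), ?_⟩
      rw [mul_div_cancel₀ _ (by norm_num), ENNReal.ofReal_toReal htop]
  obtain ⟨y, z, hym, hy, hzm, hz, hX, hN, hdd⟩ := h ε hε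
  have hc : 2 * eLpNorm y 2 μ ≠ ⊤ := ENNReal.mul_ne_top (by norm_num) hy.eLpNorm_ne_top
  filter_upwards [ENNReal.tendsto_nhds_zero.1 (tendsto_div_ofReal_sqrt hc) (ENNReal.ofReal ε)
    (by simpa using hε), eventually_ge_atTop 1] with n h1 hn
  have h0 := ofReal_sqrt_pos (n := n) (by omega)
  refine (ENNReal.div_le_div_right (eLpNorm_error_le hT hm hmT hX hym hy hzm hz hdm hd hd0 n)
    _).trans ?_
  rw [ENNReal.add_div, mul_comm (ENNReal.ofReal √(n : ℝ)),
    ENNReal.mul_div_cancel_right h0 ENNReal.ofReal_ne_top]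
  refine le_trans ?_ hεη
  calc _ ≤ ENNReal.ofReal ε + (3 * ENNReal.ofReal ε + ENNReal.ofReal ε) := by gcongr
    _ = ENNReal.ofReal (5 * ε) := by
      rw [ENNReal.ofReal_mul (by norm_num), ENNReal.ofReal_ofNat]; ring

/-- Quenched martingale approximation. -/
theorem ae_tendsto_condNorm_error (hT : MeasurePreserving T μ μ) (hm : m ≤ mΩ)
    (hmT : m ≤ m.comap T) {X d : Ω → ℝ} (hd : MemLp d 2 μ)
    (hdm : StronglyMeasurable[m.comap T] d) (hd0 : μ[d | m] =ᵐ[μ] 0)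
    (h : IsApproxDiff m μ T X d) :
    ∀ᵐ ω ∂μ, Tendsto (fun n : ℕ => condNorm m μ (shiftSum T X n - orbitSum T d n) ω /
      ENNReal.ofReal √(n : ℝ)) atTop (𝓝 0) := by
  refine ae_tendsto_zero_of_forall_exists_le fun ε hε => ?_
  -- 8 = 6 + 2: the constants of the maximal inequalities for the remainder z and for the difference
  -- e of the increments.
  obtain ⟨y, z, hym, hy, hzm, hz, hX, hN, hdd⟩ := h (ε / 8) (by positivity)
  obtain ⟨Ψ, hΨm, hΨi, hΨ⟩ := exists_condNorm_shiftSum_le hT hm hmT hz hzm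
  have hyT := hy.comp_measurePreserving hT
  have hQ : MemLp (μ[y ∘ T | m]) 2 μ := hyT.condExp one_le_two
  have hQn := fun n => hQ.comp_measurePreserving (hT.iterate n)
  have hS := memLp_shiftSum hT hz
  set e := innov m μ (y ∘ T) - d with he
  have hdL : MemLp e 2 μ := (memLp_innov (m := m) hyT).sub hd
  have hO := memLp_orbitSum hT hdL
  have hdd0 : μ[e | m] =ᵐ[μ] 0 := by
    filter_upwards [condExp_sub ((memLp_innov (m := m) hyT).integrable one_le_two)
      (hd.integrable one_le_two) m, hd0, condExp_innov hm (hyT.integrable one_le_two)]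
      with ω h1 h2 h3
    rw [he, h1, Pi.sub_apply, h2, h3]
    simp
  refine ⟨fun ω => Ψ ω + maxFun m μ T e ω,
    fun n ω => condNorm m μ (μ[y ∘ T | m]) ω / ENNReal.ofReal √(n : ℝ) +
      condNorm m μ (μ[y ∘ T | m] ∘ T^[n]) ω / ENNReal.ofReal √(n : ℝ),
    hΨm.add (measurable_maxFun hm _), ?_, ?_⟩
  · rw [lintegral_add_left hΨm]
    calc _ ≤ 6 * ENNReal.ofReal (ε / 8) + 2 * ENNReal.ofReal (ε / 8) := by
          refine add_le_add (hΨi.trans (by gcongr)) ?_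
          exact (lintegral_maxFun_le hT hm hmT hdL).trans (by gcongr)
      _ = ENNReal.ofReal (8 * (ε / 8)) := by
          rw [ENNReal.ofReal_mul (by norm_num), ENNReal.ofReal_ofNat]; ring
      _ = ENNReal.ofReal ε := by congr 1; ring
  · have hdec : ∀ᵐ ω ∂μ, ∀ n : ℕ, condNorm m μ (shiftSum T X n - orbitSum T d n) ω ≤
        condNorm m μ (μ[y ∘ T | m]) ω + condNorm m μ (μ[y ∘ T | m] ∘ T^[n]) ω +
          condNorm m μ (shiftSum T z n) ω + condNorm m μ (orbitSum T e n) ω := by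
      refine ae_all_iff.2 fun n => ?_
      filter_upwards [condNorm_congr (m := m) (shiftSum_sub_orbitSum_ae_eq hT hX d n),
        condNorm_add_le (m := m) ((hQ.sub (hQn n)).add (hS n)) (hO n),
        condNorm_add_le (m := m) (hQ.sub (hQn n)) (hS n),
        condNorm_sub_le (m := m) hQ (hQn n)] with ω h1 h2 h3 h4
      rw [h1]
      exact h2.trans (add_le_add_left (h3.trans (add_le_add_left h4 _)) _)
    filter_upwards [hΨ, hdec, condNorm_comp_iterate_isLittleO hT hm hmT hQ,
      condNorm_sum_iterate_le hT hm hmT hdL ((stronglyMeasurable_innov hmT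
        (stronglyMeasurable_comp_comap hym)).sub hdm) hdd0] with ω h1 h2 h3 h4
    refine ⟨?_, ?_⟩
    · simpa using (tendsto_div_ofReal_sqrt (c := condNorm m μ (μ[y ∘ T | m]) ω)
        ENNReal.ofReal_ne_top).add h3
    · filter_upwards [eventually_ge_atTop 1] with n hn
      have h0 := ofReal_sqrt_pos (n := n) (by omega)
      have htop : ENNReal.ofReal √(n : ℝ) ≠ ⊤ := ENNReal.ofReal_ne_top
      rw [ENNReal.div_le_iff h0 htop, add_mul, add_mul, add_mul,
        ENNReal.div_mul_cancel h0 htop, ENNReal.div_mul_cancel h0 htop, add_comm, ← add_assoc,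
        mul_comm (Ψ ω), mul_comm (maxFun _ _ _ _ _)]
      refine (h2 n).trans ?_
      gcongr
      · exact h1 n
      · exact h4 n

end Approximation

/-! ### Summation by parts: from Cesàro convergence to the iterated series -/

section Cesaro

/-- Abel summation: the partial sums H_k ≤ δk meet weights of order k^{-3}, leaving ∑ 2δ/(k(k+1)),
which telescopes. The boundary term at p is absorbed by -2δ/p. -/
theorem sum_Ico_div_le_of_sum_le {h : ℕ → ℝ} {δ : ℝ} {N : ℕ} (hN : 1 ≤ N) (h0 : ∀ k, 0 ≤ h k)
    (hH : ∀ n, N ≤ n → ∑ k ∈ Finset.range n, h k ≤ δ * n) {p : ℕ} (hp : N ≤ p) :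
    ∑ k ∈ Finset.Ico N p, h k / ((k : ℝ) * (k + 1)) ≤ 2 * δ / N := by
  have hN0 : (0 : ℝ) < N := by exact_mod_cast hN
  have hδ : 0 ≤ δ := by
    have := (Finset.sum_nonneg fun k (_ : k ∈ Finset.range N) => h0 k).trans (hH N le_rfl)
    exact nonneg_of_mul_nonneg_left this hN0
  have key : ∑ k ∈ Finset.Ico N p, h k / ((k : ℝ) * (k + 1)) ≤
      (∑ k ∈ Finset.range p, h k) / ((p : ℝ) * (p + 1)) + 2 * δ * (1 / N - 1 / p) := by
    induction p, hp using Nat.le_induction with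
    | base =>
      simp only [Finset.Ico_self, Finset.sum_empty, sub_self, mul_zero, add_zero]
      exact div_nonneg (Finset.sum_nonneg fun k _ => h0 k) (by positivity)
    | succ p hp ih =>
      have hp0 : (0 : ℝ) < p := by exact_mod_cast hN.trans hp
      rw [Finset.sum_Ico_succ_top hp]
      have h1 := hH (p + 1) (by omega)
      set H := ∑ k ∈ Finset.range (p + 1), h k with hHdef
      have h2 : ∑ k ∈ Finset.range p, h k = H - h p := by
        rw [hHdef, Finset.sum_range_succ]; ring
      rw [h2] at ih
      push_cast at h1 ⊢
      have h3 : H / ((p : ℝ) * (p + 1)) - H / (((p : ℝ) + 1) * (p + 1 + 1)) ≤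
          2 * δ * (1 / p - 1 / (p + 1)) := by
        have h4 : H / ((p : ℝ) * (p + 1)) - H / (((p : ℝ) + 1) * (p + 1 + 1)) =
            H * (2 / ((p : ℝ) * (p + 1) * (p + 2))) := by
          field_simp
          ring
        have h5 : 2 * δ * (1 / (p : ℝ) - 1 / (p + 1)) = 2 * δ / (p * (p + 1)) := by
          field_simp
          ring
        rw [h4, h5]
        calc H * (2 / ((p : ℝ) * (p + 1) * (p + 2)))
            ≤ (δ * (p + 1)) * (2 / ((p : ℝ) * (p + 1) * (p + 2))) := by gcongr
          _ = 2 * δ / (p * (p + 2)) := by field_simp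
          _ ≤ 2 * δ / (p * (p + 1)) := by gcongr; norm_num
      have h6 : (H - h p) / ((p : ℝ) * (p + 1)) + h p / ((p : ℝ) * (p + 1)) =
          H / ((p : ℝ) * (p + 1)) := by
        rw [← add_div]; ring
      have h7 : 2 * δ * (1 / (N : ℝ) - 1 / p) + 2 * δ * (1 / p - 1 / (p + 1)) =
          2 * δ * (1 / N - 1 / (p + 1)) := by ring
      linarith
  have hp0 : (0 : ℝ) < p := by exact_mod_cast hN.trans hp
  have h1 : (∑ k ∈ Finset.range p, h k) / ((p : ℝ) * (p + 1)) ≤ δ / p := by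
    rw [div_le_div_iff₀ (by positivity) hp0]
    have := hH p hp
    calc (∑ k ∈ Finset.range p, h k) * (p : ℝ) ≤ δ * p * p := by gcongr
      _ ≤ δ * (p * (p + 1)) := by nlinarith [mul_nonneg hδ hp0.le]
  have h2 : 2 * δ * (1 / (N : ℝ) - 1 / p) = 2 * δ / N - 2 * (δ / p) := by ring
  have h3 : 0 ≤ δ / p := by positivity
  linarith

variable {E : Type*} [NormedAddCommGroup E] [NormedSpace ℝ E] [CompleteSpace E]

/-- If `B k` tends to zero in Cesàro mean of the norms, then the iterated series
`∑_n ∑_{k ≥ n} (B (k+1) - B k) / (k+1)` converges to `-B 0`. -/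
theorem exists_iterated_series_of_cesaro {B : ℕ → E}
    (hB : Tendsto (fun n : ℕ => (∑ k ∈ Finset.range n, ‖B k‖) / (n : ℝ)) atTop (𝓝 0)) :
    ∃ R : ℕ → E, (∀ n, Tendsto (fun p : ℕ => ∑ k ∈ Finset.Ico n p,
        ((k : ℝ) + 1)⁻¹ • (B (k + 1) - B k)) atTop (𝓝 (R n))) ∧
      Tendsto (fun N : ℕ => ∑ n ∈ Finset.range N, R n) atTop (𝓝 (-B 0)) := by
  have hsmall : ∀ δ : ℝ, 0 < δ → ∃ K : ℕ, ∀ n, K ≤ n → ∑ k ∈ Finset.range n, ‖B k‖ ≤ δ * n := by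
    intro δ hδ
    obtain ⟨K, hK⟩ := eventually_atTop.1 (hB.eventually (ge_mem_nhds hδ))
    refine ⟨K + 1, fun n hn => ?_⟩
    have := hK n (by omega)
    rwa [div_le_iff₀ (by exact_mod_cast (by omega : 0 < n))] at this
  -- Here f 0 = 0 because 0⁻¹ = 0; the tails t N start at index N + 1 ≥ 1 and never use it.
  set f : ℕ → E := fun k => ((k : ℝ) * (k + 1))⁻¹ • B k with hf
  have hfn : ∀ k, ‖f k‖ = ‖B k‖ / ((k : ℝ) * (k + 1)) := by
    intro k
    rw [hf, norm_smul, Real.norm_of_nonneg (by positivity), div_eq_inv_mul]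
  have hsum : Summable fun k => ‖f k‖ := by
    obtain ⟨K, hK⟩ := hsmall 1 one_pos
    rw [← summable_nat_add_iff (K + 1)]
    refine summable_of_sum_range_le (fun k => norm_nonneg _) (c := 2 * 1 / ((K + 1 : ℕ) : ℝ))
      fun n => ?_
    refine le_trans (le_of_eq ?_) (sum_Ico_div_le_of_sum_le (h := fun k => ‖B k‖) (δ := 1)
      (N := K + 1) (by omega) (fun k => norm_nonneg _) (fun n hn => hK n (by omega))
      (p := K + 1 + n) (by omega))
    rw [Finset.sum_Ico_eq_sum_range, add_tsub_cancel_left]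
    refine Finset.sum_congr rfl fun k _ => ?_
    rw [hfn, add_comm k]
  have hfs : Summable f := hsum.of_norm
  set t : ℕ → E := fun N => ∑' k, f (k + (N + 1)) with ht
  have htail : ∀ δ : ℝ, 0 < δ → ∀ᶠ N : ℕ in atTop, ‖t N‖ ≤ 2 * δ / ((N : ℝ) + 1) := by
    intro δ hδ
    obtain ⟨K, hK⟩ := hsmall δ hδ
    filter_upwards [eventually_ge_atTop K] with N hN
    have hs := (summable_nat_add_iff (N + 1)).2 hsum
    refine (norm_tsum_le_tsum_norm hs).trans (Real.tsum_le_of_sum_range_le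
      (fun k => norm_nonneg _) fun n => ?_)
    have := sum_Ico_div_le_of_sum_le (h := fun k => ‖B k‖) (δ := δ)
      (N := N + 1) (by omega) (fun k => norm_nonneg _) (fun n hn => hK n (by omega))
      (p := N + 1 + n) (by omega)
    push_cast at this
    refine le_trans (le_of_eq ?_) this
    rw [Finset.sum_Ico_eq_sum_range, add_tsub_cancel_left]
    refine Finset.sum_congr rfl fun k _ => ?_
    rw [hfn, add_comm k]
  have htrec : ∀ N, t N = f (N + 1) + t (N + 1) := by
    intro N
    rw [ht]
    simp only
    rw [((summable_nat_add_iff (N + 1)).2 hfs).tsum_eq_zero_add, zero_add]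
    congr 1
    exact tsum_congr fun k => by congr 1; ring
  have hBn : Tendsto (fun n : ℕ => ((n : ℝ) + 1)⁻¹ • B n) atTop (𝓝 0) := by
    refine squeeze_zero_norm (fun n => ?_) (hB.comp (tendsto_add_atTop_nat 1))
    rw [norm_smul, Real.norm_of_nonneg (by positivity), Function.comp_apply, div_eq_inv_mul]
    push_cast
    gcongr
    exact Finset.single_le_sum (f := fun k => ‖B k‖) (fun k _ => norm_nonneg _)
      (Finset.mem_range.2 n.lt_succ_self)
  -- Abel summation of (B_{k+1} - B_k)/(k+1) from n on leaves this value. A second one gives ∑_{n<N}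
  -- R_n = -B_0 + B_N/(N+1) + N t_N, and the last two terms vanish by the Cesàro hypothesis.
  refine ⟨fun n => t n - ((n : ℝ) + 1)⁻¹ • B n, fun n => ?_, ?_⟩
  · have hid : ∀ p : ℕ, ∑ k ∈ Finset.Ico n (p + n), ((k : ℝ) + 1)⁻¹ • (B (k + 1) - B k) =
        (∑ i ∈ Finset.range p, f (i + (n + 1)) - ((n : ℝ) + 1)⁻¹ • B n) +
          (((p + n : ℕ) : ℝ) + 1)⁻¹ • B (p + n) := by
      intro p
      induction p with
      | zero => simp
      | succ p ih =>
        rw [show p + 1 + n = (p + n) + 1 by ring, Finset.sum_Ico_succ_top (by omega), ih,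
          Finset.sum_range_succ]
        rw [show p + (n + 1) = p + n + 1 by ring]
        have hx : (((p + n : ℕ) : ℝ) + 1) ≠ 0 := by positivity
        have hx' : (((p + n : ℕ) : ℝ) + 1 + 1) ≠ 0 := by positivity
        have hc : (((p + n : ℕ) : ℝ) + 1)⁻¹ = (((p + n + 1 : ℕ) : ℝ) *
            (((p + n + 1 : ℕ) : ℝ) + 1))⁻¹ + (((p + n + 1 : ℕ) : ℝ) + 1)⁻¹ := by
          push_cast at hx hx' ⊢
          field_simp
          ring
        have he : (((p + n : ℕ) : ℝ) + 1)⁻¹ • B (p + n + 1) =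
            f (p + n + 1) + (((p + n + 1 : ℕ) : ℝ) + 1)⁻¹ • B (p + n + 1) := by
          rw [hf, ← add_smul, ← hc]
        rw [smul_sub, he]
        abel
    rw [← tendsto_add_atTop_iff_nat n]
    simp_rw [hid]
    have h1 := (((summable_nat_add_iff (n + 1)).2 hfs).hasSum.tendsto_sum_nat.sub_const
      (((n : ℝ) + 1)⁻¹ • B n)).add ((tendsto_add_atTop_iff_nat n).2 hBn)
    rwa [add_zero] at h1
  · have hid : ∀ N : ℕ, ∑ n ∈ Finset.range N, (t n - ((n : ℝ) + 1)⁻¹ • B n) =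
        -B 0 + ((N : ℝ) + 1)⁻¹ • B N + (N : ℝ) • t N := by
      intro N
      induction N with
      | zero => simp
      | succ N ih =>
        rw [Finset.sum_range_succ, ih]
        have h1 : -B 0 + ((N : ℝ) + 1)⁻¹ • B N + (N : ℝ) • t N + (t N - ((N : ℝ) + 1)⁻¹ • B N) =
            -B 0 + ((N : ℝ) + 1) • t N := by
          rw [add_smul, one_smul]; abel
        rw [h1, htrec N, smul_add, hf]
        simp only
        rw [smul_smul, ← add_assoc]
        push_cast
        congr 3
        field_simp
    simp_rw [hid]
    have hNt : Tendsto (fun N : ℕ => (N : ℝ) • t N) atTop (𝓝 0) := by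
      rw [tendsto_zero_iff_norm_tendsto_zero, Metric.tendsto_nhds]
      intro ε hε
      filter_upwards [htail (ε / 4) (by positivity)] with N hN
      rw [Real.dist_0_eq_abs, abs_of_nonneg (norm_nonneg _), norm_smul, Real.norm_natCast]
      calc (N : ℝ) * ‖t N‖ ≤ (N + 1) * (2 * (ε / 4) / (N + 1)) := by
            gcongr
            linarith
        _ = ε / 2 := by field_simp; norm_num
        _ < ε := by linarith
    simpa using (tendsto_const_nhds (x := -B 0)).add hBn |>.add hNt

end Cesaro

/-! ### Orthogonal decomposition and identification of the series -/

section Bessel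

variable {Ω : Type*} {m : MeasurableSpace Ω} [mΩ : MeasurableSpace Ω] {μ : Measure Ω}
  [IsProbabilityMeasure μ] {T : Ω → Ω}

theorem integral_add_sq_of_condExp_zero (hm : m ≤ mΩ) {u v : Ω → ℝ} (hu : MemLp u 2 μ)
    (hv : MemLp v 2 μ) (hvm : StronglyMeasurable[m] v) (h0 : μ[u | m] =ᵐ[μ] 0) :
    ∫ ω, (u ω + v ω) ^ 2 ∂μ = ∫ ω, u ω ^ 2 ∂μ + ∫ ω, v ω ^ 2 ∂μ := by
  have hcross : ∫ ω, (v * u) ω ∂μ = 0 := by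
    rw [← integral_condExp hm, integral_congr_ae (condExp_mul_of_stronglyMeasurable_left hvm
      (hv.integrable_mul hu) (hu.integrable one_le_two))]
    refine integral_eq_zero_of_ae (h0.mono fun ω h => ?_)
    rw [Pi.mul_apply, h]
    simp
  have hexp : ∀ ω, (u ω + v ω) ^ 2 = u ω ^ 2 + v ω ^ 2 + 2 * (v * u) ω := fun ω => by
    rw [Pi.mul_apply]; ring
  simp_rw [hexp]
  have hi : Integrable (fun ω => u ω ^ 2 + v ω ^ 2) μ := hu.integrable_sq.add hv.integrable_sq
  rw [integral_add hi ((hv.integrable_mul hu).const_mul 2),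
    integral_add hu.integrable_sq hv.integrable_sq, integral_const_mul, hcross]
  simp

theorem integral_innov_sq_le (hm : m ≤ mΩ) {G : Ω → ℝ} (hG : MemLp G 2 μ) :
    ∫ ω, innov m μ G ω ^ 2 ∂μ ≤ ∫ ω, G ω ^ 2 ∂μ := by
  have h := integral_add_sq_of_condExp_zero hm (memLp_innov (m := m) hG)
    (hG.condExp (m := m) one_le_two) stronglyMeasurable_condExp
    (condExp_innov hm (hG.integrable one_le_two))
  have h1 : ∀ ω, innov m μ G ω + (μ[G | m]) ω = G ω := fun ω => by simp [innov]
  simp_rw [h1] at h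
  rw [h]
  exact le_add_of_nonneg_right (integral_nonneg fun ω => sq_nonneg _)

/-- The increment `E(f | T⁻¹ m) - E(f | m)`. -/
noncomputable def condIncr {Ω : Type*} (m : MeasurableSpace Ω) [MeasurableSpace Ω]
    (μ : Measure Ω) (T : Ω → Ω) (f : Ω → ℝ) : Ω → ℝ := μ[f | m.comap T] - μ[f | m]

theorem memLp_condIncr {f : Ω → ℝ} (hf : MemLp f 2 μ) : MemLp (condIncr m μ T f) 2 μ :=
  (hf.condExp one_le_two).sub (hf.condExp one_le_two)

theorem integral_innov_sq_eq (hT : MeasurePreserving T μ μ) (hm : m ≤ mΩ)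
    (hmT : m ≤ m.comap T) {G : Ω → ℝ} (hG : MemLp G 2 μ) :
    ∫ ω, innov m μ G ω ^ 2 ∂μ =
      ∫ ω, innov (m.comap T) μ G ω ^ 2 ∂μ + ∫ ω, condIncr m μ T G ω ^ 2 ∂μ := by
  have h := integral_add_sq_of_condExp_zero (comap_le_of_measurePreserving hT hm)
    (memLp_innov (m := m.comap T) hG) (memLp_condIncr (m := m) (T := T) hG)
    (stronglyMeasurable_condExp.sub (stronglyMeasurable_condExp.mono hmT))
    (condExp_innov (comap_le_of_measurePreserving hT hm) (hG.integrable one_le_two))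
  rw [← h]
  refine integral_congr_ae (Eventually.of_forall fun ω => ?_)
  simp [innov, condIncr]

/-- With G_n = S_n - M_n, the sum equals ‖G_n - E(G_n | m)‖². Indeed G_{n+1} = (X ∘ T - d) + G_n ∘ T
with a T⁻¹m-measurable bracket, so centring G_{n+1} on T⁻¹m reproduces the previous step composed
with T. The increment from m to T⁻¹m is orthogonal to it and supplies the new term. -/
theorem sum_integral_condIncr_sq_le (hT : MeasurePreserving T μ μ) (hm : m ≤ mΩ)
    (hmT : m ≤ m.comap T) {X d : Ω → ℝ} (hX : MemLp X 2 μ) (hXm : StronglyMeasurable[m] X)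
    (hd : MemLp d 2 μ) (hdm : StronglyMeasurable[m.comap T] d) (hd0 : μ[d | m] =ᵐ[μ] 0) (n : ℕ) :
    ∑ k ∈ Finset.range n, ∫ ω, (condIncr m μ T (shiftSum T X (k + 1)) - d) ω ^ 2 ∂μ ≤
      ∫ ω, (shiftSum T X n - orbitSum T d n) ω ^ 2 ∂μ := by
  have hle := comap_le_of_measurePreserving hT hm
  set G : ℕ → Ω → ℝ := fun n => shiftSum T X n - orbitSum T d n with hGdef
  have hO := memLp_orbitSum hT hd
  have hS := memLp_shiftSum hT hX
  have hG : ∀ n, MemLp (G n) 2 μ := fun n => (hS n).sub (hO n)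
  have hO0 : ∀ n, μ[orbitSum T d n | m] =ᵐ[μ] 0 := fun n =>
    condExp_sum_iterate_ae_zero hT hm hmT hd hd0 n
  have hOT : ∀ n, μ[orbitSum T d (n + 1) | m.comap T] =ᵐ[μ] d := by
    intro n
    have hrec : orbitSum T d (n + 1) = d + orbitSum T d n ∘ T := sum_iterate_succ d n
    rw [hrec]
    filter_upwards [condExp_add (hd.integrable one_le_two)
      (((hO n).comp_measurePreserving hT).integrable one_le_two) (m.comap T),
      condExp_comp_comap hT hm ((hO n).integrable one_le_two),
      hT.quasiMeasurePreserving.ae_eq_comp (hO0 n)] with ω h1 h2 h3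
    have h3 : (μ[orbitSum T d n | m]) (T ω) = 0 := h3
    rw [h1, Pi.add_apply, h2, Function.comp_apply, h3,
      condExp_of_stronglyMeasurable hle hdm (hd.integrable one_le_two), add_zero]
  have hincr : ∀ n, condIncr m μ T (G (n + 1)) =ᵐ[μ]
      condIncr m μ T (shiftSum T X (n + 1)) - d := by
    intro n
    filter_upwards [condExp_sub ((hS (n + 1)).integrable one_le_two)
        ((hO (n + 1)).integrable one_le_two) m,
      condExp_sub ((hS (n + 1)).integrable one_le_two)
        ((hO (n + 1)).integrable one_le_two) (m.comap T), hOT n, hO0 (n + 1)] with ω h1 h2 h3 h4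
    simp only [condIncr, Pi.sub_apply, hGdef] at h1 h2 ⊢
    rw [h1, h2, h3, h4, Pi.zero_apply]
    ring
  have hGrec : ∀ n, innov (m.comap T) μ (G (n + 1)) =ᵐ[μ] innov m μ (G n) ∘ T := by
    intro n
    have h1 : G (n + 1) = (X ∘ T - d) + G n ∘ T := by
      have h2 : orbitSum T d (n + 1) = d + orbitSum T d n ∘ T := sum_iterate_succ d n
      have h3 : shiftSum T X (n + 1) = X ∘ T + shiftSum T X n ∘ T := by
        rw [add_comm n 1, shiftSum_add]
        congr 1
        funext ω
        simp [shiftSum]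
      rw [hGdef]
      simp only [h2, h3]
      funext ω
      simp
      ring
    have hh : MemLp (X ∘ T - d) 2 μ := (hX.comp_measurePreserving hT).sub hd
    have hhm : StronglyMeasurable[m.comap T] (X ∘ T - d) :=
      (stronglyMeasurable_comp_comap hXm).sub hdm
    rw [h1]
    filter_upwards [condExp_add (hh.integrable one_le_two)
      (((hG n).comp_measurePreserving hT).integrable one_le_two) (m.comap T),
      condExp_comp_comap hT hm ((hG n).integrable one_le_two)] with ω h4 h5
    rw [innov, Pi.sub_apply, h4, Pi.add_apply, Pi.add_apply, h5,
      condExp_of_stronglyMeasurable hle hhm (hh.integrable one_le_two)]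
    simp [innov]
  have key : ∀ n, ∫ ω, innov m μ (G n) ω ^ 2 ∂μ =
      ∑ k ∈ Finset.range n, ∫ ω, (condIncr m μ T (shiftSum T X (k + 1)) - d) ω ^ 2 ∂μ := by
    intro n
    induction n with
    | zero =>
      have : G 0 = 0 := by funext; simp [hGdef, shiftSum, orbitSum]
      simp [this, innov]
    | succ n ih =>
      rw [Finset.sum_range_succ, ← ih, integral_innov_sq_eq hT hm hmT (hG (n + 1))]
      congr 1
      · rw [← integral_comp_measurePreserving hT (memLp_innov (hG n)).integrable_sq]
        exact integral_congr_ae ((hGrec n).mono fun ω h => by simp only [h, Function.comp_apply])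
      · exact integral_congr_ae ((hincr n).mono fun ω h => by simp only [h])
  rw [← key n]
  exact integral_innov_sq_le hm (hG n)

theorem condIncr_shiftSum_ae_eq (hT : MeasurePreserving T μ μ) {X : Ω → ℝ} (hX : MemLp X 2 μ)
    (n : ℕ) : condIncr m μ T (shiftSum T X n) =ᵐ[μ]
      fun ω => ∑ k ∈ Finset.range n, condIncr m μ T (X ∘ T^[k + 1]) ω := by
  have h1 : shiftSum T X n = ∑ j ∈ Finset.range n, X ∘ T^[j + 1] := by
    funext ω; simp [shiftSum]
  have hi : ∀ j ∈ Finset.range n, Integrable (X ∘ T^[j + 1]) μ := fun j _ =>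
    (hX.comp_measurePreserving (hT.iterate _)).integrable one_le_two
  rw [h1]
  filter_upwards [condExp_finsetSum hi m, condExp_finsetSum hi (m.comap T)] with ω h2 h3
  simp only [condIncr, Pi.sub_apply, h2, h3, Finset.sum_apply, Finset.sum_sub_distrib]

/-- The iterated series of the increments converges in `L²` to the approximating martingale
difference. -/
theorem exists_iterated_series_condIncr (hT : MeasurePreserving T μ μ) (hm : m ≤ mΩ)
    (hmT : m ≤ m.comap T) {X d : Ω → ℝ} (hX : MemLp X 2 μ) (hXm : StronglyMeasurable[m] X)
    (hd : MemLp d 2 μ) (hdm : StronglyMeasurable[m.comap T] d) (hd0 : μ[d | m] =ᵐ[μ] 0)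
    (h : Tendsto (fun n : ℕ => eLpNorm (shiftSum T X n - orbitSum T d n) 2 μ /
      ENNReal.ofReal √(n : ℝ)) atTop (𝓝 0)) :
    ∃ R : ℕ → Ω → ℝ, (∀ n, MemLp (R n) 2 μ ∧ Tendsto (fun p : ℕ => eLpNorm
        (fun ω => (∑ k ∈ Finset.Ico n p, condIncr m μ T (X ∘ T^[k + 1]) ω / ((k : ℝ) + 1)) - R n ω)
        2 μ) atTop (𝓝 0)) ∧
      Tendsto (fun N : ℕ => eLpNorm (fun ω => (∑ n ∈ Finset.range N, R n ω) - d ω) 2 μ)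
        atTop (𝓝 0) := by
  have haL : ∀ k, MemLp (condIncr m μ T (X ∘ T^[k + 1])) 2 μ := fun k =>
    memLp_condIncr (hX.comp_measurePreserving (hT.iterate _))
  set a : ℕ → Lp ℝ 2 μ := fun k => (haL k).toLp _ with ha
  set D : Lp ℝ 2 μ := hd.toLp d with hD
  -- Chosen so that B_{k+1} - B_k = a_k and -B_0 = D, the value of the iterated series.
  set B : ℕ → Lp ℝ 2 μ := fun n => ∑ k ∈ Finset.range n, a k - D with hB
  have hBa : ∀ k, B (k + 1) - B k = a k := fun k => by
    simp only [hB, Finset.sum_range_succ]; abel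
  have hGL : ∀ n, MemLp (shiftSum T X n - orbitSum T d n) 2 μ := fun n =>
    (memLp_shiftSum hT hX n).sub (memLp_orbitSum hT hd n)
  have hnorm : ∀ n, ‖B n‖ ^ 2 = ∫ ω, (condIncr m μ T (shiftSum T X n) - d) ω ^ 2 ∂μ := by
    intro n
    have hL : MemLp (condIncr m μ T (shiftSum T X n) - d) 2 μ :=
      (memLp_condIncr (memLp_shiftSum hT hX n)).sub hd
    have h1 : B n = hL.toLp _ := by
      refine Lp.ext ?_
      filter_upwards [hL.coeFn_toLp, Lp.coeFn_sub (∑ k ∈ Finset.range n, a k) D,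
        Lp.coeFn_finsetSum (Finset.range n) a, hd.coeFn_toLp,
        ae_all_iff.2 fun k => (haL k).coeFn_toLp, condIncr_shiftSum_ae_eq (m := m) hT hX n]
        with ω h2 h3 h4 h5 h6 h7
      rw [hB, h3, h2, Pi.sub_apply, Pi.sub_apply, h4, h5, h7, Finset.sum_apply]
      simp only [ha, h6]
    rw [h1, Lp.norm_toLp, eLpNorm_two_eq hL, ENNReal.toReal_ofReal (Real.sqrt_nonneg _),
      Real.sq_sqrt (integral_nonneg fun ω => sq_nonneg _)]
  set g : ℕ → ℝ := fun n => √(∫ ω, (shiftSum T X n - orbitSum T d n) ω ^ 2 ∂μ) with hg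
  have hg0 : Tendsto (fun n : ℕ => g n / √(n : ℝ)) atTop (𝓝 0) := by
    have h1 := (ENNReal.tendsto_toReal ENNReal.zero_ne_top).comp h
    rw [ENNReal.toReal_zero] at h1
    refine h1.congr fun n => ?_
    rw [Function.comp_apply, ENNReal.toReal_div, eLpNorm_two_eq (hGL n),
      ENNReal.toReal_ofReal (Real.sqrt_nonneg _), ENNReal.toReal_ofReal (Real.sqrt_nonneg _)]
  -- Cauchy–Schwarz and the Bessel bound; since g n = o(√n), the right side is o(n).
  have hsum : ∀ n : ℕ, ∑ k ∈ Finset.range n, ‖B (k + 1)‖ ≤ √(n : ℝ) * g n := by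
    intro n
    have h1 := sum_integral_condIncr_sq_le hT hm hmT hX hXm hd hdm hd0 n
    simp_rw [← hnorm] at h1
    have h2 := sq_sum_le_card_mul_sum_sq (s := Finset.range n) (f := fun k => ‖B (k + 1)‖)
    rw [Finset.card_range] at h2
    rw [hg, ← Real.sqrt_mul (by positivity)]
    refine Real.le_sqrt_of_sq_le (h2.trans ?_)
    gcongr
  have hces : Tendsto (fun n : ℕ => (∑ k ∈ Finset.range n, ‖B k‖) / (n : ℝ)) atTop (𝓝 0) := by
    have h1 : Tendsto (fun n : ℕ => g n / √(n : ℝ) + ‖B 0‖ / (n : ℝ)) atTop (𝓝 0) := by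
      simpa using hg0.add (tendsto_const_div_atTop_nhds_zero_nat ‖B 0‖)
    refine squeeze_zero (fun n => by positivity) (fun n => ?_) h1
    rcases Nat.eq_zero_or_pos n with rfl | hn
    · simp
    have hn0 : (0 : ℝ) < n := by exact_mod_cast hn
    have h2 : g n / √(n : ℝ) = √(n : ℝ) * g n / n := by
      rw [div_eq_div_iff (Real.sqrt_pos.2 hn0).ne' hn0.ne', mul_right_comm,
        Real.mul_self_sqrt hn0.le, mul_comm]
    rw [h2, ← add_div]
    gcongr
    calc ∑ k ∈ Finset.range n, ‖B k‖ ≤ ∑ k ∈ Finset.range (n + 1), ‖B k‖ :=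
          Finset.sum_le_sum_of_subset_of_nonneg (Finset.range_mono n.le_succ)
            fun _ _ _ => norm_nonneg _
      _ = ∑ k ∈ Finset.range n, ‖B (k + 1)‖ + ‖B 0‖ := Finset.sum_range_succ' _ n
      _ ≤ _ := by gcongr; exact hsum n
  obtain ⟨R, hR, hRD⟩ := exists_iterated_series_of_cesaro hces
  have hconv : ∀ {F : ℕ → Lp ℝ 2 μ} {L : Lp ℝ 2 μ} {φ : ℕ → Ω → ℝ},
      Tendsto F atTop (𝓝 L) → (∀ n, (F n - L : Lp ℝ 2 μ) =ᵐ[μ] φ n) →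
      Tendsto (fun n => eLpNorm (φ n) 2 μ) atTop (𝓝 0) := by
    intro F L φ hF hφ
    have h1 := (tendsto_iff_edist_tendsto_0).1 hF
    refine h1.congr fun n => ?_
    rw [Lp.edist_def, ← eLpNorm_congr_ae (hφ n), ← eLpNorm_congr_ae (Lp.coeFn_sub _ _)]
  refine ⟨fun n => R n, fun n => ⟨Lp.memLp _, hconv (hR n) fun p => ?_⟩, hconv hRD fun N => ?_⟩
  · simp_rw [hBa]
    filter_upwards [Lp.coeFn_sub (∑ k ∈ Finset.Ico n p, ((k : ℝ) + 1)⁻¹ • a k) (R n),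
      Lp.coeFn_finsetSum (Finset.Ico n p) (fun k => ((k : ℝ) + 1)⁻¹ • a k),
      ae_all_iff.2 fun k : ℕ => Lp.coeFn_smul (((k : ℝ) + 1)⁻¹) (a k),
      ae_all_iff.2 fun k => (haL k).coeFn_toLp] with ω h1 h2 h3 h4
    rw [h1, Pi.sub_apply, h2, Finset.sum_apply]
    congr 1
    refine Finset.sum_congr rfl fun k _ => ?_
    rw [h3, Pi.smul_apply, ha, h4, smul_eq_mul, div_eq_inv_mul]
  · have hB0 : -B 0 = D := by simp [hB]
    rw [hB0]
    filter_upwards [Lp.coeFn_sub (∑ n ∈ Finset.range N, R n) D,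
      Lp.coeFn_finsetSum (Finset.range N) R, hd.coeFn_toLp] with ω h1 h2 h3
    rw [h1, Pi.sub_apply, h2, h3, Finset.sum_apply]

end Bessel

/-! ### Back to the two-sided notation -/

section Transfer

variable {Ω : Type*} {F₀ : MeasurableSpace Ω} [mΩ : MeasurableSpace Ω] {μ : Measure Ω}
  [IsProbabilityMeasure μ] {θ : Ω ≃ᵐ Ω}

theorem iter_natCast (θ : Ω ≃ᵐ Ω) (n : ℕ) : iter θ (n : ℤ) = (⇑θ)^[n] := by
  rw [iter, zpow_natCast, Equiv.Perm.coe_pow]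
  rfl

theorem iter_neg_one (θ : Ω ≃ᵐ Ω) : iter θ (0 - 1) = ⇑θ.symm := by
  rw [iter, zero_sub, zpow_neg_one]
  rfl

theorem partialSum_eq_shiftSum (θ : Ω ≃ᵐ Ω) (Z : Ω → ℝ) (n : ℕ) :
    partialSum θ Z n = shiftSum θ Z n := by
  funext ω
  simp only [partialSum, shiftSum, iter_natCast]
  rw [Finset.range_eq_Ico, Finset.sum_Ico_add' (fun k => Z ((⇑θ)^[k] ω)) 0 n 1]
  rfl

theorem orbitSum_comp (T : Ω → Ω) (Z : Ω → ℝ) (n : ℕ) :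
    orbitSum T (Z ∘ T) n = shiftSum T Z n := by
  funext ω
  simp only [orbitSum, shiftSum, Function.comp_apply, Function.iterate_succ_apply']

theorem orbitSum_congr {T : Ω → Ω} (hT : MeasurePreserving T μ μ) {f g : Ω → ℝ}
    (h : f =ᵐ[μ] g) (n : ℕ) : orbitSum T f n =ᵐ[μ] orbitSum T g n := by
  filter_upwards [ae_all_iff.2 fun j : ℕ =>
    (hT.iterate j).quasiMeasurePreserving.ae_eq_comp h] with ω h
  exact Finset.sum_congr rfl fun j _ => h j

/-- The projection `P_0`, shifted by `θ`, is the increment of the conditional expectations. -/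
theorem proj_comp_ae_eq (hθ : MeasurePreserving θ μ μ) (hF₀ : F₀ ≤ mΩ) {f : Ω → ℝ}
    (hf : Integrable f μ) : proj F₀ μ θ 0 f ∘ θ =ᵐ[μ] condIncr F₀ μ θ (f ∘ θ) := by
  have h0 : sigmaAlg F₀ θ 0 = F₀ := sigmaAlg_zero F₀ θ
  have h1 : sigmaAlg F₀ θ (0 - 1) = F₀.comap θ.symm := by rw [sigmaAlg, iter_neg_one]
  have h1le : F₀.comap θ.symm ≤ mΩ :=
    (MeasurableSpace.comap_mono hF₀).trans θ.symm.measurable.comap_le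
  -- Composition with θ moves the pair (F₋₁, F₀) to (F₀, F₁), which is why `condIncr` goes up from
  -- `m` to T⁻¹m.
  have h2 : (F₀.comap θ.symm).comap θ = F₀ := by
    rw [MeasurableSpace.comap_comp, MeasurableEquiv.symm_comp_self, MeasurableSpace.comap_id]
  have h3 := condExp_comp_comap hθ h1le hf
  rw [h2] at h3
  rw [proj, h0, h1]
  filter_upwards [condExp_comp_comap hθ hF₀ hf, h3] with ω h4 h5
  simp only [condIncr, Function.comp_apply, Pi.sub_apply] at h4 h5 ⊢
  rw [h4, h5]

theorem memLp_comp_iter (hθ : MeasurePreserving θ μ μ) {X : Ω → ℝ} (hX : MemLp X 2 μ) (k : ℕ) :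
    MemLp (fun ω' => X (iter θ (k : ℤ) ω')) 2 μ := by
  rw [iter_natCast]
  exact hX.comp_measurePreserving (hθ.iterate k)

theorem memLp_proj {f : Ω → ℝ} (hf : MemLp f 2 μ) (k : ℤ) : MemLp (proj F₀ μ θ k f) 2 μ :=
  (hf.condExp one_le_two).sub (hf.condExp one_le_two)

theorem memLp_sum_proj (hθ : MeasurePreserving θ μ μ) {X : Ω → ℝ} (hX : MemLp X 2 μ) (s : Finset ℕ) :
    MemLp (fun ω => ∑ k ∈ s, proj F₀ μ θ 0 (fun ω' => X (iter θ (k : ℤ) ω')) ω / ((k : ℝ) + 1))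
      2 μ := by
  refine memLp_finsetSum _ fun k _ => ?_
  simp_rw [div_eq_inv_mul]
  exact (memLp_proj (memLp_comp_iter hθ hX k) 0).const_mul _

theorem isMartingaleDiff_of_comp (hθ : MeasurePreserving θ μ μ) (hF₀ : F₀ ≤ mΩ) {X d : Ω → ℝ}
    (hX : MemLp X 2 μ) (hd : MemLp d 2 μ)
    (h : ∃ R : ℕ → Ω → ℝ, (∀ n, MemLp (R n) 2 μ ∧ Tendsto (fun p : ℕ => eLpNorm
        (fun ω => (∑ k ∈ Finset.Ico n p, condIncr F₀ μ θ (X ∘ θ^[k + 1]) ω / ((k : ℝ) + 1)) - R n ω)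
        2 μ) atTop (𝓝 0)) ∧
      Tendsto (fun N : ℕ => eLpNorm (fun ω => (∑ n ∈ Finset.range N, R n ω) - d ω) 2 μ)
        atTop (𝓝 0)) : IsMartingaleDiff F₀ μ θ X (d ∘ θ.symm) := by
  obtain ⟨R, hR, hRd⟩ := h
  have hs : MeasurePreserving θ.symm μ μ := hθ.symm θ
  have hRL : ∀ n, MemLp (R n ∘ θ.symm) 2 μ := fun n => (hR n).1.comp_measurePreserving hs
  have hdL : MemLp (d ∘ θ.symm) 2 μ := hd.comp_measurePreserving hs
  refine ⟨fun n => R n ∘ θ.symm, fun n => ⟨hRL n, ?_⟩, hdL, ?_⟩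
  · refine (hR n).2.congr fun p => ?_
    have hL := (memLp_sum_proj (F₀ := F₀) hθ hX (Finset.Ico n p)).sub (hRL n)
    refine Eq.trans ?_ (eLpNorm_comp_measurePreserving hL.aestronglyMeasurable hθ)
    refine eLpNorm_congr_ae ?_
    have h1 : ∀ᵐ ω ∂μ, ∀ k : ℕ, (proj F₀ μ θ 0 (fun ω' => X (iter θ (k : ℤ) ω')) ∘ θ) ω =
        condIncr F₀ μ θ (X ∘ θ^[k + 1]) ω := by
      refine ae_all_iff.2 fun k => ?_
      refine (proj_comp_ae_eq hθ hF₀ ((memLp_comp_iter hθ hX k).integrable one_le_two)).trans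
        (Eventually.of_forall fun ω => ?_)
      rw [iter_natCast]
      rfl
    filter_upwards [h1] with ω h1
    simp only [Function.comp_apply, MeasurableEquiv.symm_apply_apply] at h1 ⊢
    simp_rw [h1]
  · refine hRd.congr fun N => ?_
    have hL : MemLp (fun ω => (∑ n ∈ Finset.range N, (R n ∘ θ.symm) ω) - (d ∘ θ.symm) ω) 2 μ :=
      (memLp_finsetSum _ fun n _ => hRL n).sub hdL
    refine Eq.trans ?_ (eLpNorm_comp_measurePreserving hL.aestronglyMeasurable hθ)
    congr 1
    funext ω
    simp

theorem ae_eq_of_tendsto_eLpNorm {f : ℕ → Ω → ℝ} {g h : Ω → ℝ} (hf : ∀ n, MemLp (f n) 2 μ)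
    (hg : MemLp g 2 μ) (hh : MemLp h 2 μ)
    (h1 : Tendsto (fun n => eLpNorm (fun ω => f n ω - g ω) 2 μ) atTop (𝓝 0))
    (h2 : Tendsto (fun n => eLpNorm (fun ω => f n ω - h ω) 2 μ) atTop (𝓝 0)) : g =ᵐ[μ] h := by
  have hle : ∀ n, eLpNorm (g - h) 2 μ ≤ eLpNorm (fun ω => f n ω - h ω) 2 μ +
      eLpNorm (fun ω => f n ω - g ω) 2 μ := by
    intro n
    have h3 : g - h = (fun ω => f n ω - h ω) - fun ω => f n ω - g ω := by
      funext ω; simp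
    rw [h3]
    exact eLpNorm_sub_le ((hf n).sub hh).aestronglyMeasurable
      ((hf n).sub hg).aestronglyMeasurable one_le_two
  have hlim := h2.add h1
  rw [add_zero] at hlim
  have h0 : eLpNorm (g - h) 2 μ = 0 := le_antisymm (ge_of_tendsto' hlim hle) zero_le
  rw [eLpNorm_eq_zero_iff (hg.sub hh).aestronglyMeasurable two_ne_zero] at h0
  filter_upwards [h0] with ω h0
  exact sub_eq_zero.1 h0

/-- The `L²` limit defining `D` is unique. -/
theorem IsMartingaleDiff.ae_eq (hθ : MeasurePreserving θ μ μ) {X D D' : Ω → ℝ}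
    (hX : MemLp X 2 μ) (h : IsMartingaleDiff F₀ μ θ X D) (h' : IsMartingaleDiff F₀ μ θ X D') :
    D =ᵐ[μ] D' := by
  obtain ⟨R, hR, hD, hRD⟩ := h
  obtain ⟨R', hR', hD', hRD'⟩ := h'
  have hRR : ∀ n, R n =ᵐ[μ] R' n := fun n =>
    ae_eq_of_tendsto_eLpNorm (fun p => memLp_sum_proj hθ hX (Finset.Ico n p)) (hR n).1 (hR' n).1
      (hR n).2 (hR' n).2
  refine ae_eq_of_tendsto_eLpNorm (fun N => memLp_finsetSum (Finset.range N)
    fun n _ => (hR n).1) hD hD' hRD (hRD'.congr fun N => eLpNorm_congr_ae ?_)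
  filter_upwards [ae_all_iff.2 hRR] with ω h
  simp [h]

end Transfer

/-! ### Conditional Jensen and the passage to little-o -/

section Conclusion

variable {Ω : Type*} {m : MeasurableSpace Ω} [mΩ : MeasurableSpace Ω] {μ : Measure Ω}
  [IsProbabilityMeasure μ]

theorem sq_condExp_le_condExp_sq (hm : m ≤ mΩ) {G : Ω → ℝ} (hG : MemLp G 2 μ) :
    ∀ᵐ ω ∂μ, (μ[G | m]) ω ^ 2 ≤ (μ[fun ω' => G ω' ^ 2 | m]) ω := by
  have h0 : 0 ≤ᵐ[μ] ProbabilityTheory.condVar m G μ :=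
    condExp_nonneg (Eventually.of_forall fun ω => sq_nonneg _)
  filter_upwards [h0, ProbabilityTheory.condVar_ae_eq_condExp_sq_sub_sq_condExp hm hG]
    with ω h1 h2
  rw [h2] at h1
  have h3 : (0 : ℝ) ≤ (μ[fun ω' => G ω' ^ 2 | m]) ω - (μ[G | m]) ω ^ 2 := h1
  linarith

theorem condExp_sq_isLittleO {G : ℕ → Ω → ℝ}
    (h : ∀ᵐ ω ∂μ, Tendsto (fun n : ℕ => condNorm m μ (G n) ω / ENNReal.ofReal √(n : ℝ))
      atTop (𝓝 0)) :
    ∀ᵐ ω ∂μ, (fun n : ℕ => (μ[fun ω' => G n ω' ^ 2 | m]) ω) =o[atTop] fun n : ℕ => (n : ℝ) := by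
  have hnn : ∀ᵐ ω ∂μ, ∀ n, 0 ≤ (μ[fun ω' => G n ω' ^ 2 | m]) ω :=
    ae_all_iff.2 fun n => condExp_nonneg (Eventually.of_forall fun ω => sq_nonneg _)
  filter_upwards [h, hnn] with ω h1 h2
  have h3 := (((ENNReal.tendsto_toReal ENNReal.zero_ne_top).comp h1).pow 2)
  rw [ENNReal.toReal_zero, zero_pow two_ne_zero] at h3
  refine (isLittleO_iff_tendsto' ?_).2 (h3.congr fun n => ?_)
  · filter_upwards [eventually_ge_atTop 1] with n hn h0
    exact absurd h0 (by exact_mod_cast (by omega : n ≠ 0))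
  · rw [Function.comp_apply, condNorm, ENNReal.toReal_div, ENNReal.toReal_ofReal (Real.sqrt_nonneg _),
      ENNReal.toReal_ofReal (Real.sqrt_nonneg _), div_pow, Real.sq_sqrt (h2 n),
      Real.sq_sqrt (by positivity)]

end Conclusion

end QuenchedApprox

theorem mainTheorem4 {Ω : Type*} (F₀ : MeasurableSpace Ω) [mΩ : MeasurableSpace Ω]
    (μ : Measure Ω) [IsProbabilityMeasure μ]
    (θ : Ω ≃ᵐ Ω) (hθ : MeasurePreserving θ μ μ)
    (hF₀ : F₀ ≤ mΩ) (hF₀θ : F₀ ≤ MeasurableSpace.comap θ F₀)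
    (X₀ : Ω → ℝ) (hX₀ : Measurable[F₀] X₀) (hX₀2 : MemLp X₀ 2 μ) (hX₀c : ∫ ω, X₀ ω ∂μ = 0)
    (hMW : QuenchedApprox.MaxwellWoodroofe F₀ μ θ X₀) :
    (∃ D : Ω → ℝ, QuenchedApprox.IsMartingaleDiff F₀ μ θ X₀ D) ∧
    ∀ D : Ω → ℝ, QuenchedApprox.IsMartingaleDiff F₀ μ θ X₀ D →
      let S : ℕ → Ω → ℝ := QuenchedApprox.partialSum θ X₀
      let M : ℕ → Ω → ℝ := QuenchedApprox.partialSum θ D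
      (∀ᵐ ω ∂μ, (fun n : ℕ => (μ[fun ω' => (S n ω' - M n ω' - (μ[S n | F₀]) ω') ^ 2 | F₀]) ω)
        =o[atTop] (fun n : ℕ => (n : ℝ))) ∧
      (∀ᵐ ω ∂μ, (fun n : ℕ => (μ[S n | F₀]) ω) =o[atTop] (fun n : ℕ => Real.sqrt (n : ℝ))) ∧
      (∀ᵐ ω ∂μ, (fun n : ℕ => (μ[fun ω' => (S n ω' - M n ω') ^ 2 | F₀]) ω)
        =o[atTop] (fun n : ℕ => (n : ℝ))) := by
  have hXm : StronglyMeasurable[F₀] X₀ := hX₀.stronglyMeasurable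
  obtain ⟨d, hd, hdm, hd0, hda⟩ := QuenchedApprox.exists_isApproxDiff hθ hF₀ hF₀θ hX₀2 hXm (by
    rw [QuenchedApprox.MaxwellWoodroofe] at hMW
    simpa only [QuenchedApprox.partialSum_eq_shiftSum] using hMW)
  have hL2 := QuenchedApprox.tendsto_eLpNorm_error hθ hF₀ hF₀θ hd hdm hd0 hda
  have hD₀ : QuenchedApprox.IsMartingaleDiff F₀ μ θ X₀ (d ∘ θ.symm) :=
    QuenchedApprox.isMartingaleDiff_of_comp hθ hF₀ hX₀2 hd
      (QuenchedApprox.exists_iterated_series_condIncr hθ hF₀ hF₀θ hX₀2 hXm hd hdm hd0 hL2)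
  refine ⟨⟨_, hD₀⟩, fun D hD => ?_⟩
  intro S M
  have hSeq : ∀ n, S n = QuenchedApprox.shiftSum θ X₀ n :=
    QuenchedApprox.partialSum_eq_shiftSum θ X₀
  have hSL : ∀ n, MemLp (S n) 2 μ := fun n => by
    rw [hSeq]; exact QuenchedApprox.memLp_shiftSum hθ hX₀2 n
  have hOL := QuenchedApprox.memLp_orbitSum hθ hd
  -- Uniqueness of the L² limits reduces an arbitrary D to the constructed one, d ∘ θ⁻¹.
  have hDd : D ∘ θ =ᵐ[μ] d := by
    have h := hθ.quasiMeasurePreserving.ae_eq_comp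
      (QuenchedApprox.IsMartingaleDiff.ae_eq hθ hX₀2 hD hD₀)
    rwa [Function.comp_assoc, MeasurableEquiv.symm_comp_self, Function.comp_id] at h
  have hMO : ∀ n, M n =ᵐ[μ] QuenchedApprox.orbitSum θ d n := fun n => by
    have h1 : M n = QuenchedApprox.orbitSum θ (D ∘ θ) n := by
      rw [QuenchedApprox.orbitSum_comp]
      exact QuenchedApprox.partialSum_eq_shiftSum θ D n
    rw [h1]
    exact QuenchedApprox.orbitSum_congr hθ hDd n
  have hML : ∀ n, MemLp (M n) 2 μ := fun n => (memLp_congr_ae (hMO n)).2 (hOL n)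
  have hG : ∀ n, MemLp (S n - M n) 2 μ := fun n => (hSL n).sub (hML n)
  have hGae : ∀ n, S n - M n =ᵐ[μ]
      QuenchedApprox.shiftSum θ X₀ n - QuenchedApprox.orbitSum θ d n := fun n => by
    rw [hSeq]
    filter_upwards [hMO n] with ω h
    rw [Pi.sub_apply, Pi.sub_apply, h]
  -- Since E₀(M_n) = 0, the quantity in the first claim is the conditional variance of S_n - M_n,
  -- and E₀(S_n)² is at most its conditional second moment.
  have hES : ∀ n, μ[S n - M n | F₀] =ᵐ[μ] μ[S n | F₀] := fun n => by
    filter_upwards [condExp_sub ((hSL n).integrable one_le_two) ((hML n).integrable one_le_two) F₀,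
      condExp_congr_ae (m := F₀) (hMO n),
      QuenchedApprox.condExp_sum_iterate_ae_zero hθ hF₀ hF₀θ hd hd0 n] with ω h1 h2 h3
    have h4 : (μ[QuenchedApprox.orbitSum θ d n | F₀]) ω = 0 := h3
    rw [h1, Pi.sub_apply, h2, h4, sub_zero]
  have hthird : ∀ᵐ ω ∂μ, (fun n : ℕ => (μ[fun ω' => (S n ω' - M n ω') ^ 2 | F₀]) ω)
      =o[atTop] (fun n : ℕ => (n : ℝ)) := by
    refine QuenchedApprox.condExp_sq_isLittleO (G := fun n => S n - M n) ?_
    filter_upwards [QuenchedApprox.ae_tendsto_condNorm_error hθ hF₀ hF₀θ hd hdm hd0 hda,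
      ae_all_iff.2 fun n => QuenchedApprox.condNorm_congr (m := F₀) (hGae n)] with ω h1 h2
    simpa only [h2] using h1
  refine ⟨?_, ?_, hthird⟩
  · have hle : ∀ᵐ ω ∂μ, ∀ n : ℕ,
        (μ[fun ω' => (S n ω' - M n ω' - (μ[S n | F₀]) ω') ^ 2 | F₀]) ω ≤
          (μ[fun ω' => (S n ω' - M n ω') ^ 2 | F₀]) ω := by
      refine ae_all_iff.2 fun n => ?_
      have h1 : (fun ω' => (S n ω' - M n ω' - (μ[S n | F₀]) ω') ^ 2) =ᵐ[μ]
          fun ω' => ((S n - M n) ω' - (μ[S n - M n | F₀]) ω') ^ 2 := by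
        filter_upwards [hES n] with ω h
        rw [h, Pi.sub_apply]
      exact (condExp_congr_ae h1).le.trans
        (ProbabilityTheory.condVar_ae_le_condExp_sq hF₀ (hG n))
    have hnn : ∀ᵐ ω ∂μ, ∀ n : ℕ,
        0 ≤ (μ[fun ω' => (S n ω' - M n ω' - (μ[S n | F₀]) ω') ^ 2 | F₀]) ω :=
      ae_all_iff.2 fun n => condExp_nonneg (Eventually.of_forall fun ω => sq_nonneg _)
    filter_upwards [hthird, hle, hnn] with ω h1 h2 h3
    refine IsBigO.trans_isLittleO (IsBigO.of_norm_le fun n => ?_) h1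
    rw [Real.norm_of_nonneg (h3 n)]
    exact h2 n
  · have hle : ∀ᵐ ω ∂μ, ∀ n : ℕ, (μ[S n | F₀]) ω ^ 2 ≤
        (μ[fun ω' => (S n ω' - M n ω') ^ 2 | F₀]) ω := by
      refine ae_all_iff.2 fun n => ?_
      filter_upwards [QuenchedApprox.sq_condExp_le_condExp_sq hF₀ (hG n), hES n] with ω h1 h2
      rwa [h2] at h1
    filter_upwards [hthird, hle] with ω h1 h2
    rw [isLittleO_iff] at h1 ⊢
    intro c hc
    -- The bound with constant c² for the squares yields c for E₀(S_n) against √n.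
    filter_upwards [h1 (sq_pos_of_pos hc)] with n hn
    have hn0 : (0 : ℝ) ≤ n := Nat.cast_nonneg n
    rw [Real.norm_of_nonneg hn0] at hn
    have h3 := (h2 n).trans ((le_abs_self _).trans hn)
    rw [Real.norm_eq_abs, Real.norm_of_nonneg (Real.sqrt_nonneg _)]
    refine abs_le_of_sq_le_sq ?_ (by positivity)
    rw [mul_pow, Real.sq_sqrt hn0]
    exact h3
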